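/- Let $D=\{z\in\mathbb C:|z|<1\}$ and let $H(D)$ be the set of analytic functions on $D$. For $\alpha>0$ let $\mathcal Z^\alpha$ be the space of all $f\in H(D)$ with $\sup_{z\in D}(1-|z|^2)^\alpha|f''(z)|<\infty$, with the norm $$\|f\|_{\mathcal Z^\alpha}=|f(0)|+|f'(0)|+\sup_{z\in D}(1-|z|^2)^\alpha|f''(z)|.$$ For $\beta>0$ and $u\in H(D)$ put $\|u\|_{v_\beta}=\sup_{z\in D}(1-|z|^2)^\beta|u(z)|\in[0,\infty]$. For an analytic self-map $\varphi:D\to D$ and $g\in H(D)$ let $$(C_\varphi U_gf)(z)=\int_0^{\varphi(z)}f(\xi)g'(\xi)\,d\xi,\qquad z\in D .$$ The essential norm of a bounded linear operator $T:X\to Y$ is $\|T\|_{e}=\inf\{\|T+K\|_{X\to Y}:K:X\to Y\text{ compact linear}\}$. Write $u=(g'\circ\varphi)(\varphi')^2$ and $w=(g''\circ\varphi)(\varphi')^2+(g'\circ\varphi)\varphi''$. **Theorem 3.2.** Let $\alpha,\beta>0$. There are constants $C_1,C_2>0$, depending only on $\alpha$ and $\beta$, such that the following holds for every analytic self-map $\varphi$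 of $D$ and every $g\in H(D)$ for which $T=C_\varphi U_g:\mathcal Z^\alpha\to\mathcal Z^\beta$ is a bounded operator; here $a\asymp b$ means $C_1a\le b\le C_2a$ (in particular, the right-hand sides below are finite). (i) If $0<\alpha<1$, then $T$ is compact and $\|T\|_e=0$. (ii) If $\alpha=1$, then $\|T\|_e\asymp\limsup_{n\to\infty}(\log n)\,\|u\varphi^n\|_{v_\beta}$. (iii) If $1<\alpha<2$, then $\|T\|_e\asymp\limsup_{n\to\infty}(n+1)^{\alpha-1}\|u\varphi^n\|_{v_\beta}$. (iv) If $\alpha=2$, then $\|T\|_e\asymp\max\{\limsup_{n\to\infty}(n+1)\|u\varphi^n\|_{v_\beta},\ \limsup_{n\to\infty}(\log n)\,\|w\varphi^n\|_{v_\beta}\}$. (v) If $\alpha>2$, then $\|T\|_e\asymp\max\{\limsup_{n\to\infty}(n+1)^{\alpha-1}\|u\varphi^n\|_{v_\beta},\ \limsup_{n\to\infty}(n+1)^{\alpha-2}\|w\varphi^n\|_{v_\beta}\}$. -/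

import Mathlib

open scoped ENNReal

noncomputable section

/-- The standard weight `v_α(z) = (1 - |z|²)^α`. -/
def stdWeight (α : ℝ) (z : ℂ) : ℝ := (1 - ‖z‖ ^ 2) ^ α

/-- The weighted sup-norm `‖f‖_v = sup_{z ∈ D} v(z)|f(z)|` over the open unit disk, as an extended
nonnegative number (so that it is meaningful also when the supremum is infinite). -/
def weightedNorm (v : ℂ → ℝ) (f : ℂ → ℂ) : ℝ≥0∞ :=
  ⨆ z ∈ Metric.ball (0 : ℂ) 1, ENNReal.ofReal (v z * ‖f z‖)

/-- Holomorphic functions on the unit disk with `sup_{z ∈ D} (1 - |z|²)^α |f''(z)| < ∞`.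
A function on the disk is represented by its extension by zero to `ℂ`, so that
two elements are equal exactly when they agree on the disk. -/
def zygmundSubmodule (α : ℝ) : Submodule ℂ (ℂ → ℂ) where
  carrier := {f | DifferentiableOn ℂ f (Metric.ball 0 1) ∧ (∀ z ∉ Metric.ball (0 : ℂ) 1, f z = 0) ∧
    ∃ C : ℝ, ∀ z ∈ Metric.ball (0 : ℂ) 1, stdWeight α z * ‖deriv (deriv f) z‖ ≤ C}
  zero_mem' := by
    refine ⟨differentiableOn_const 0, fun _ _ => rfl, 0, fun z _ => ?_⟩
    have h0 : deriv (0 : ℂ → ℂ) = 0 := by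
      funext w
      exact deriv_const w (0 : ℂ)
    simp [h0]
  add_mem' := by
    rintro f g ⟨hf, hf0, C, hC⟩ ⟨hg, hg0, C', hC'⟩
    refine ⟨hf.add hg, fun z hz => by simp [hf0 z hz, hg0 z hz], C + C', fun z hz => ?_⟩
    have hd : ∀ w ∈ Metric.ball (0 : ℂ) 1, deriv (f + g) w = (deriv f + deriv g) w := fun w hw =>
      deriv_add (hf.differentiableAt (Metric.isOpen_ball.mem_nhds hw))
        (hg.differentiableAt (Metric.isOpen_ball.mem_nhds hw))
    have h2 : deriv (deriv (f + g)) z = deriv (deriv f) z + deriv (deriv g) z := by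
      rw [(Filter.eventuallyEq_of_mem (Metric.isOpen_ball.mem_nhds hz) hd).deriv_eq]
      exact deriv_add ((hf.deriv Metric.isOpen_ball).differentiableAt
        (Metric.isOpen_ball.mem_nhds hz)) ((hg.deriv Metric.isOpen_ball).differentiableAt
        (Metric.isOpen_ball.mem_nhds hz))
    have hw : 0 ≤ stdWeight α z := by
      have : ‖z‖ < 1 := by simpa using hz
      exact Real.rpow_nonneg (by nlinarith [norm_nonneg z]) _
    rw [h2]
    have := mul_le_mul_of_nonneg_left (norm_add_le (deriv (deriv f) z) (deriv (deriv g) z)) hw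
    linarith [hC z hz, hC' z hz]
  smul_mem' := by
    rintro c f ⟨hf, hf0, C, hC⟩
    refine ⟨hf.const_smul c, fun z hz => by simp [hf0 z hz], ‖c‖ * C, fun z hz => ?_⟩
    have h1 : deriv (c • f) = c • deriv f := by
      funext w
      exact deriv_const_smul_field c f
    have h2 : deriv (deriv (c • f)) z = c * deriv (deriv f) z := by
      rw [h1]
      exact deriv_const_smul_field c (deriv f)
    rw [h2, norm_mul, mul_left_comm]
    exact mul_le_mul_of_nonneg_left (hC z hz) (norm_nonneg c)

/-- The Zygmund type space `𝒵^α`. -/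
def ZygmundSpace (α : ℝ) : Type := zygmundSubmodule α

namespace ZygmundSpace

instance (α : ℝ) : AddCommGroup (ZygmundSpace α) :=
  inferInstanceAs (AddCommGroup (zygmundSubmodule α))

instance (α : ℝ) : Module ℂ (ZygmundSpace α) :=
  inferInstanceAs (Module ℂ (zygmundSubmodule α))

/-- The underlying function. -/
def toFun {α : ℝ} (f : ZygmundSpace α) : ℂ → ℂ := Subtype.val (p := (· ∈ zygmundSubmodule α)) f

instance (α : ℝ) : CoeFun (ZygmundSpace α) (fun _ => ℂ → ℂ) := ⟨toFun⟩

/-- `‖f‖_{𝒵^α} = |f(0)| + |f'(0)| + sup_{z ∈ D} (1 - |z|²)^α |f''(z)|`. -/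
instance (α : ℝ) : Norm (ZygmundSpace α) :=
  ⟨fun f => ‖f 0‖ + ‖deriv f 0‖ +
    ⨆ z : Metric.ball (0 : ℂ) 1, stdWeight α z * ‖deriv (deriv f) z‖⟩

variable {α : ℝ}

theorem norm_def (f : ZygmundSpace α) : ‖f‖ = ‖f 0‖ + ‖deriv f 0‖ +
    ⨆ z : Metric.ball (0 : ℂ) 1, stdWeight α z * ‖deriv (deriv f) z‖ := rfl

theorem weight_pos (α : ℝ) {z : ℂ} (hz : z ∈ Metric.ball (0 : ℂ) 1) : 0 < stdWeight α z := by
  have : ‖z‖ < 1 := by simpa using hz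
  exact Real.rpow_pos_of_pos (by nlinarith [norm_nonneg z]) _

theorem bddAbove (f : ZygmundSpace α) :
    BddAbove (Set.range fun z : Metric.ball (0 : ℂ) 1 => stdWeight α z * ‖deriv (deriv f) z‖) := by
  obtain ⟨C, hC⟩ := f.2.2.2
  exact ⟨C, by rintro _ ⟨z, rfl⟩; exact hC z z.2⟩

theorem sup_nonneg (f : ZygmundSpace α) :
    0 ≤ ⨆ z : Metric.ball (0 : ℂ) 1, stdWeight α z * ‖deriv (deriv f) z‖ :=
  Real.iSup_nonneg fun z => mul_nonneg (weight_pos α z.2).le (norm_nonneg _)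

theorem diffAt (f : ZygmundSpace α) {z : ℂ} (hz : z ∈ Metric.ball (0 : ℂ) 1) :
    DifferentiableAt ℂ f z := f.2.1.differentiableAt (Metric.isOpen_ball.mem_nhds hz)

theorem diffAt_deriv (f : ZygmundSpace α) {z : ℂ} (hz : z ∈ Metric.ball (0 : ℂ) 1) :
    DifferentiableAt ℂ (deriv f) z :=
  (f.2.1.deriv Metric.isOpen_ball).differentiableAt (Metric.isOpen_ball.mem_nhds hz)

theorem deriv_add' (f g : ZygmundSpace α) {z : ℂ} (hz : z ∈ Metric.ball (0 : ℂ) 1) :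
    deriv (f + g : ZygmundSpace α) z = deriv f z + deriv g z :=
  deriv_add (diffAt f hz) (diffAt g hz)

theorem deriv2_add (f g : ZygmundSpace α) {z : ℂ} (hz : z ∈ Metric.ball (0 : ℂ) 1) :
    deriv (deriv (f + g : ZygmundSpace α)) z = deriv (deriv f) z + deriv (deriv g) z := by
  have : deriv (f + g : ZygmundSpace α) =ᶠ[nhds z] (deriv f + deriv g) :=
    Filter.eventuallyEq_of_mem (Metric.isOpen_ball.mem_nhds hz) fun w hw => deriv_add' f g hw
  rw [this.deriv_eq]
  exact deriv_add (diffAt_deriv f hz) (diffAt_deriv g hz)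

theorem deriv_smul' (c : ℂ) (f : ZygmundSpace α) :
    deriv (c • f : ZygmundSpace α) = c • deriv f := by
  funext w
  exact deriv_const_smul_field c f.toFun

theorem deriv2_smul (c : ℂ) (f : ZygmundSpace α) :
    deriv (deriv (c • f : ZygmundSpace α)) = c • deriv (deriv f) := by
  rw [deriv_smul']
  funext w
  exact deriv_const_smul_field c (deriv f)

theorem norm_core (α : ℝ) : NormedSpace.Core ℂ (ZygmundSpace α) where
  norm_nonneg f := by
    rw [norm_def]
    have := sup_nonneg f
    positivity
  norm_smul c f := by
    have h0 : (c • f : ZygmundSpace α) 0 = c * f 0 := rfl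
    rw [norm_def, norm_def, h0, deriv2_smul, deriv_smul', mul_add, mul_add,
      Real.mul_iSup_of_nonneg (norm_nonneg c)]
    simp only [Pi.smul_apply, smul_eq_mul, norm_mul, mul_left_comm]
  norm_triangle f g := by
    have h0 : (f + g : ZygmundSpace α) 0 = f 0 + g 0 := rfl
    have hz : (0 : ℂ) ∈ Metric.ball (0 : ℂ) 1 := by simp
    rw [norm_def, norm_def, norm_def, h0, deriv_add' f g hz]
    have : Nonempty (Metric.ball (0 : ℂ) 1) := ⟨⟨0, hz⟩⟩
    have h3 : (⨆ z : Metric.ball (0 : ℂ) 1,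
        stdWeight α z * ‖deriv (deriv (f + g : ZygmundSpace α)) z‖) ≤
        (⨆ z : Metric.ball (0 : ℂ) 1, stdWeight α z * ‖deriv (deriv f) z‖) +
        ⨆ z : Metric.ball (0 : ℂ) 1, stdWeight α z * ‖deriv (deriv g) z‖ := by
      refine ciSup_le fun z => ?_
      rw [deriv2_add f g z.2]
      have h := mul_le_mul_of_nonneg_left
        (norm_add_le (deriv (deriv f) z) (deriv (deriv g) z)) (weight_pos α z.2).le
      have h1 := le_ciSup (bddAbove f) z
      have h2 := le_ciSup (bddAbove g) z
      linarith
    linarith [norm_add_le (f 0) (g 0), norm_add_le (deriv f 0) (deriv g 0)]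
  norm_eq_zero_iff f := by
    constructor
    · intro h
      rw [norm_def] at h
      have hs := sup_nonneg f
      have hz : (0 : ℂ) ∈ Metric.ball (0 : ℂ) 1 := by simp
      have hf0 : f 0 = 0 := norm_eq_zero.1 (by linarith [norm_nonneg (f 0), norm_nonneg (deriv f 0)])
      have hf1 : deriv f 0 = 0 :=
        norm_eq_zero.1 (by linarith [norm_nonneg (f 0), norm_nonneg (deriv f 0)])
      have hpc : IsPreconnected (Metric.ball (0 : ℂ) 1) := (convex_ball 0 1).isPreconnected
      have h2 : Set.EqOn (deriv (deriv f)) 0 (Metric.ball (0 : ℂ) 1) := fun z hz => by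
        have h1 := le_ciSup (bddAbove f) ⟨z, hz⟩
        have hp := weight_pos α hz
        have h3 : stdWeight α z * ‖deriv (deriv f) z‖ ≤ 0 := by
          simp only at h1
          linarith [norm_nonneg (f 0), norm_nonneg (deriv f 0)]
        exact norm_le_zero_iff.1 (nonpos_of_mul_nonpos_right h3 hp)
      have h1 : Set.EqOn (deriv f) 0 (Metric.ball (0 : ℂ) 1) := fun z hz' => by
        have := Metric.isOpen_ball.is_const_of_deriv_eq_zero hpc
          (f.2.1.deriv Metric.isOpen_ball) h2 hz' hz
        exact this.trans hf1
      apply Subtype.ext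
      funext z
      by_cases hz' : z ∈ Metric.ball (0 : ℂ) 1
      · have := Metric.isOpen_ball.is_const_of_deriv_eq_zero hpc f.2.1 h1 hz' hz
        exact this.trans hf0
      · exact f.2.2.1 z hz'
    · rintro rfl
      have h0 : ((0 : ZygmundSpace α) : ℂ → ℂ) = fun _ => 0 := rfl
      have h1 : deriv (fun _ : ℂ => (0 : ℂ)) = fun _ => 0 := by
        funext w
        simp
      rw [norm_def, h0, h1, h1]
      simp

instance (α : ℝ) : NormedAddCommGroup (ZygmundSpace α) := .ofCore (norm_core α)

instance (α : ℝ) : NormedSpace ℂ (ZygmundSpace α) := .ofCore (norm_core α)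

end ZygmundSpace

/-- The Volterra type operator `U_g f(w) = ∫_0^w f(ξ) g'(ξ) dξ`, the integral being taken along the
segment from `0` to `w`. -/
def volterraU (g f : ℂ → ℂ) (w : ℂ) : ℂ :=
  ∫ t in (0 : ℝ)..1, f (t * w) * deriv g (t * w) * w

/-- `(C_φ U_g f)(z) = ∫_0^{φ(z)} f(ξ) g'(ξ) dξ`. -/
def compVolterraU (φ g f : ℂ → ℂ) (z : ℂ) : ℂ := volterraU g f (φ z)

/-- The essential norm `inf {‖T + K‖ : K : X → Y compact}`. -/
def essNorm {X Y : Type*} [NormedAddCommGroup X] [NormedSpace ℂ X]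
    [NormedAddCommGroup Y] [NormedSpace ℂ Y] (T : X →L[ℂ] Y) : ℝ :=
  sInf {r | ∃ K : X →L[ℂ] Y, IsCompactOperator K ∧ r = ‖T + K‖}

/-- `C₁ a ≤ b ≤ C₂ a`. -/
def Comparable (C₁ C₂ : ℝ) (a b : ℝ≥0∞) : Prop :=
  ENNReal.ofReal C₁ * a ≤ b ∧ b ≤ ENNReal.ofReal C₂ * a

/-- `(g' ∘ φ)(φ')²`. -/
def symbolU (φ g : ℂ → ℂ) (z : ℂ) : ℂ := deriv g (φ z) * deriv φ z ^ 2

/-- `(g'' ∘ φ)(φ')² + (g' ∘ φ)φ''`. -/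
def symbolW (φ g : ℂ → ℂ) (z : ℂ) : ℂ :=
  deriv (deriv g) (φ z) * deriv φ z ^ 2 + deriv g (φ z) * deriv (deriv φ) z

/-- `limsup_{n → ∞} c(n) ‖u φⁿ‖_{v_β}`, in `[0, ∞]`. -/
def limsupPow (β : ℝ) (c : ℕ → ℝ) (u φ : ℂ → ℂ) : ℝ≥0∞ :=
  Filter.limsup (fun n : ℕ =>
    ENNReal.ofReal (c n) * weightedNorm (stdWeight β) (fun z => u z * φ z ^ n)) Filter.atTop

end

-- Differentiating twice gives `(T f)'' = u · (f' ∘ φ) + w · (f ∘ φ)`, so everything reduces to the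
-- size of `f` and `f'` near the boundary, weighted by `w` and `u`. Integrating the bound on `f''`
-- along radii, `f'` grows like `1`, `log (1 - |z|)⁻¹` or `(1 - |z|)^(1 - α)` according as `α < 1`,
-- `α = 1` or `α > 1`; the thresholds for `f`, with growth `(1 - |z|)^(2 - α)` above it, lie at `α =
-- 2`.
--
-- Upper bound. Let `L` send `f` to a Taylor polynomial of a dilation `f(r ·)`. It has finite rank,
-- and `f - L f` is small on a fixed smaller disk, while near the boundary it obeys the growth
-- bounds up to a small error (`DilationBound.exists_compact`). Hence `T - T L` is controlled by `u`
-- and `w` times these growth functions where `|φ|` is near `1` (`exists_compact_norm_add_le`). A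
-- growth function at `x` is at most a constant times `c(k) xᵏ` with `k` about `1 / (2(1 - x))`,
-- because then `xᵏ ≥ 1/2`; this turns the weighted symbols into the quantities `c(k) ‖u φᵏ‖`
-- (`DominatedBy`). Whenever a growth function is bounded, the dilations converge uniformly on the
-- disk and the corresponding term disappears.
--
-- Lower bound. The test functions are polynomials that are bounded in norm and whose second
-- derivatives tend to zero locally uniformly. Compact operators send them to zero by a gliding
-- hump: sums of sparse subsequences stay bounded (`IsCompactOperator.eventually_norm_le`), so no
-- duality is needed. Normalized monomials give bounds on `n u φⁿ⁻¹ + w φⁿ`. For `1 < α < 2` the `w`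
-- term is negligible; for `α ≥ 2`, comparing degrees `n` and `2n` eliminates `w` and isolates `u`,
-- and `w` follows by subtraction when `α > 2`. The logarithmic cases use blocks of degrees from `m`
-- to `m²`, over which the harmonic sum is comparable to `log m`, rotated so that all terms are
-- positive at the point `φ(z)`.

local notation "𝔻" => Metric.ball (0 : ℂ) 1

/-! ### Elementary properties of the Zygmund norm -/

namespace ZygmundSpace

variable {α : ℝ}

theorem norm_apply_zero_le (f : ZygmundSpace α) : ‖f 0‖ ≤ ‖f‖ := by
  rw [norm_def]
  linarith [sup_nonneg f, norm_nonneg (deriv f 0)]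

theorem norm_deriv_zero_le (f : ZygmundSpace α) : ‖deriv f 0‖ ≤ ‖f‖ := by
  rw [norm_def]
  linarith [sup_nonneg f, norm_nonneg (f 0)]

theorem weight_mul_norm_deriv2_le (f : ZygmundSpace α) {z : ℂ} (hz : z ∈ 𝔻) :
    stdWeight α z * ‖deriv (deriv f) z‖ ≤ ‖f‖ := by
  have h := le_ciSup (bddAbove f) ⟨z, hz⟩
  rw [norm_def]
  simp only at h
  linarith [norm_nonneg (f 0), norm_nonneg (deriv f 0)]

theorem norm_le_of_forall (f : ZygmundSpace α) {A B C : ℝ} (hA : ‖f 0‖ ≤ A)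
    (hB : ‖deriv f 0‖ ≤ B)
    (hC : ∀ z ∈ 𝔻, stdWeight α z * ‖deriv (deriv f) z‖ ≤ C) : ‖f‖ ≤ A + B + C := by
  have : Nonempty 𝔻 := ⟨⟨0, by simp⟩⟩
  rw [norm_def]
  have := ciSup_le fun z : 𝔻 => hC z z.2
  linarith

theorem differentiableOn (f : ZygmundSpace α) : DifferentiableOn ℂ f 𝔻 := f.2.1

theorem add_apply (f g : ZygmundSpace α) (z : ℂ) : (f + g : ZygmundSpace α) z = f z + g z := rfl

theorem sub_apply (f g : ZygmundSpace α) (z : ℂ) : (f - g : ZygmundSpace α) z = f z - g z := rfl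

theorem smul_apply (c : ℂ) (f : ZygmundSpace α) (z : ℂ) :
    (c • f : ZygmundSpace α) z = c * f z := rfl

theorem sum_apply {ι : Type*} (s : Finset ι) (f : ι → ZygmundSpace α) (z : ℂ) :
    (∑ i ∈ s, f i : ZygmundSpace α) z = ∑ i ∈ s, f i z := by
  classical
  induction s using Finset.induction_on with
  | empty => rfl
  | insert a s ha ih => rw [Finset.sum_insert ha, Finset.sum_insert ha, add_apply, ih]

theorem sub_eq_add_smul (f g : ZygmundSpace α) : f - g = f + (-1 : ℂ) • g := by
  rw [neg_one_smul, sub_eq_add_neg]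

theorem deriv_sub' (f g : ZygmundSpace α) {z : ℂ} (hz : z ∈ 𝔻) :
    deriv (f - g : ZygmundSpace α) z = deriv f z - deriv g z := by
  rw [sub_eq_add_smul, deriv_add' _ _ hz, deriv_smul']
  simp [sub_eq_add_neg]

theorem deriv2_sub (f g : ZygmundSpace α) {z : ℂ} (hz : z ∈ 𝔻) :
    deriv (deriv (f - g : ZygmundSpace α)) z = deriv (deriv f) z - deriv (deriv g) z := by
  rw [sub_eq_add_smul, deriv2_add _ _ hz, deriv2_smul]
  simp [sub_eq_add_neg]

/-- The Taylor coefficients at the origin, without the factorials, are additive. -/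
theorem iteratedDeriv_add_apply (f g : ZygmundSpace α) (n : ℕ) :
    iteratedDeriv n (f + g : ZygmundSpace α) 0 = iteratedDeriv n f 0 + iteratedDeriv n g 0 := by
  have h : ∀ f : ZygmundSpace α, ContDiffAt ℂ n f 0 := fun f =>
    ((f.differentiableOn.contDiffOn Metric.isOpen_ball).contDiffAt
      (Metric.isOpen_ball.mem_nhds (by simp)))
  exact iteratedDeriv_add (h f) (h g)

theorem iteratedDeriv_smul_apply (c : ℂ) (f : ZygmundSpace α) (n : ℕ) :
    iteratedDeriv n (c • f : ZygmundSpace α) 0 = c * iteratedDeriv n f 0 := by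
  have h : ContDiffAt ℂ n f 0 :=
    ((f.differentiableOn.contDiffOn Metric.isOpen_ball).contDiffAt
      (Metric.isOpen_ball.mem_nhds (by simp)))
  exact iteratedDeriv_const_smul h c

end ZygmundSpace

theorem stdWeight_le_one {α : ℝ} (hα : 0 ≤ α) {z : ℂ} (hz : z ∈ 𝔻) : stdWeight α z ≤ 1 := by
  have : ‖z‖ < 1 := by simpa using hz
  exact Real.rpow_le_one (by nlinarith [norm_nonneg z]) (by nlinarith [norm_nonneg z]) hα

/-! ### Polynomials in the Zygmund type space -/

section Poly

open Polynomial

/-- The restriction of a polynomial to the disk, extended by zero. -/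
noncomputable def diskPoly (p : ℂ[X]) : ℂ → ℂ := Set.indicator 𝔻 fun z => p.eval z

theorem diskPoly_apply (p : ℂ[X]) {z : ℂ} (hz : z ∈ 𝔻) : diskPoly p z = p.eval z :=
  Set.indicator_of_mem hz _

theorem diskPoly_eventuallyEq (p : ℂ[X]) {z : ℂ} (hz : z ∈ 𝔻) :
    diskPoly p =ᶠ[nhds z] fun z => p.eval z :=
  Filter.eventuallyEq_of_mem (Metric.isOpen_ball.mem_nhds hz) fun _ hw => diskPoly_apply p hw

theorem deriv_diskPoly (p : ℂ[X]) {z : ℂ} (hz : z ∈ 𝔻) :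
    deriv (diskPoly p) z = p.derivative.eval z := by
  rw [(diskPoly_eventuallyEq p hz).deriv_eq, Polynomial.deriv]

theorem deriv2_diskPoly (p : ℂ[X]) {z : ℂ} (hz : z ∈ 𝔻) :
    deriv (deriv (diskPoly p)) z = p.derivative.derivative.eval z := by
  have : deriv (diskPoly p) =ᶠ[nhds z] fun z => p.derivative.eval z :=
    Filter.eventuallyEq_of_mem (Metric.isOpen_ball.mem_nhds hz) fun _ hw => deriv_diskPoly p hw
  rw [this.deriv_eq, Polynomial.deriv]

theorem Polynomial.exists_norm_eval_le (p : ℂ[X]) : ∃ C, ∀ z ∈ 𝔻, ‖p.eval z‖ ≤ C := by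
  obtain ⟨C, hC⟩ := (isCompact_closedBall (0 : ℂ) 1).exists_bound_of_continuousOn
    (f := fun z => p.eval z) p.continuous.continuousOn
  exact ⟨C, fun z hz => hC z (Metric.ball_subset_closedBall hz)⟩

variable {α : ℝ}

/-- Polynomials as elements of the Zygmund type space. -/
noncomputable def ZygmundSpace.ofPoly (hα : 0 ≤ α) (p : ℂ[X]) : ZygmundSpace α :=
  ⟨diskPoly p, p.differentiableOn.congr fun _ hz => diskPoly_apply p hz,
    fun _ hz => Set.indicator_of_notMem hz _, by
      obtain ⟨C, hC⟩ := p.derivative.derivative.exists_norm_eval_le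
      refine ⟨C, fun z hz => ?_⟩
      rw [deriv2_diskPoly p hz]
      have h1 := stdWeight_le_one hα hz
      nlinarith [hC z hz, norm_nonneg (p.derivative.derivative.eval z)]⟩

namespace ZygmundSpace

theorem ofPoly_apply (hα : 0 ≤ α) (p : ℂ[X]) {z : ℂ} (hz : z ∈ 𝔻) :
    ofPoly hα p z = p.eval z := diskPoly_apply p hz

theorem deriv_ofPoly (hα : 0 ≤ α) (p : ℂ[X]) {z : ℂ} (hz : z ∈ 𝔻) :
    deriv (ofPoly hα p) z = p.derivative.eval z := deriv_diskPoly p hz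

theorem deriv2_ofPoly (hα : 0 ≤ α) (p : ℂ[X]) {z : ℂ} (hz : z ∈ 𝔻) :
    deriv (deriv (ofPoly hα p)) z = p.derivative.derivative.eval z := deriv2_diskPoly p hz

end ZygmundSpace

end Poly

/-! ### Derivatives of the Volterra type operator -/

section Operator

variable {φ g : ℂ → ℂ}

theorem mul_mem_disk {t : ℝ} (ht : t ∈ Set.Icc (0 : ℝ) 1) {w : ℂ} (hw : w ∈ 𝔻) :
    (t : ℂ) * w ∈ 𝔻 := by
  have h : ‖w‖ < 1 := by simpa using hw
  have : ‖(t : ℂ) * w‖ < 1 := by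
    rw [norm_mul, Complex.norm_real, Real.norm_eq_abs, abs_of_nonneg ht.1]
    nlinarith [norm_nonneg w, ht.1, ht.2]
  simpa using this

/-- The integrand has a primitive `F` on the disk, and the fundamental theorem of calculus along the
segment identifies the integral with `F w - F 0`. -/
theorem hasDerivAt_volterraU {f : ℂ → ℂ} (hf : DifferentiableOn ℂ f 𝔻)
    (hg : DifferentiableOn ℂ g 𝔻) {w : ℂ} (hw : w ∈ 𝔻) :
    HasDerivAt (volterraU g f) (f w * deriv g w) w := by
  have hd : DifferentiableOn ℂ (fun w => f w * deriv g w) 𝔻 :=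
    hf.mul (hg.deriv Metric.isOpen_ball)
  obtain ⟨F, hF⟩ := hd.isExactOn_ball
  have key : ∀ w ∈ 𝔻, volterraU g f w = F w - F 0 := by
    intro w hw
    have h1 : ∀ t ∈ Set.uIcc (0 : ℝ) 1, HasDerivAt (fun t : ℝ => F (t * w))
        (f (t * w) * deriv g (t * w) * w) t := by
      intro t ht
      rw [Set.uIcc_of_le zero_le_one] at ht
      have h2 : HasDerivAt (fun t : ℝ => (t : ℂ) * w) w t := by
        simpa using (Complex.ofRealCLM.hasDerivAt (x := t)).mul_const w
      exact (hF _ (mul_mem_disk ht hw)).comp t h2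
    have hcont : ContinuousOn (fun t : ℝ => f (t * w) * deriv g (t * w) * w)
        (Set.uIcc (0 : ℝ) 1) := by
      rw [Set.uIcc_of_le zero_le_one]
      refine (hd.continuousOn.comp (f := fun t : ℝ => (t : ℂ) * w) (by fun_prop) ?_).mul
        continuousOn_const
      exact fun t ht => mul_mem_disk ht hw
    have := intervalIntegral.integral_eq_sub_of_hasDerivAt h1 hcont.intervalIntegrable
    rw [volterraU, this]
    simp
  have h3 : volterraU g f =ᶠ[nhds w] fun w => F w - F 0 :=
    Filter.eventuallyEq_of_mem (Metric.isOpen_ball.mem_nhds hw) key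
  exact ((hF w hw).sub_const _).congr_of_eventuallyEq h3

theorem norm_volterraU_le {f : ℂ → ℂ} {w : ℂ} {A B : ℝ}
    (hf : ∀ z, ‖z‖ ≤ ‖w‖ → ‖f z‖ ≤ A) (hg : ∀ z, ‖z‖ ≤ ‖w‖ → ‖deriv g z‖ ≤ B) :
    ‖volterraU g f w‖ ≤ A * B * ‖w‖ := by
  have hA : 0 ≤ A := (norm_nonneg _).trans (hf 0 (by simp))
  have := intervalIntegral.norm_integral_le_of_norm_le_const (a := (0 : ℝ)) (b := 1)
    (C := A * B * ‖w‖) (f := fun t : ℝ => f (t * w) * deriv g (t * w) * w) ?_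
  · simpa [volterraU] using this
  · intro t ht
    rw [Set.uIoc_of_le zero_le_one] at ht
    have h1 : ‖(t : ℂ) * w‖ ≤ ‖w‖ := by
      rw [norm_mul, Complex.norm_real, Real.norm_eq_abs, abs_of_nonneg ht.1.le]
      nlinarith [norm_nonneg w, ht.2]
    rw [norm_mul, norm_mul]
    gcongr
    exacts [hf _ h1, hg _ h1]

theorem deriv_compVolterraU (hφ : DifferentiableOn ℂ φ 𝔻) (hm : Set.MapsTo φ 𝔻 𝔻)
    (hg : DifferentiableOn ℂ g 𝔻) {F f : ℂ → ℂ} (hf : DifferentiableOn ℂ f 𝔻)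
    (hF : ∀ z ∈ 𝔻, F z = compVolterraU φ g f z) {z : ℂ} (hz : z ∈ 𝔻) :
    deriv F z = f (φ z) * deriv g (φ z) * deriv φ z := by
  have h1 : F =ᶠ[nhds z] compVolterraU φ g f :=
    Filter.eventuallyEq_of_mem (Metric.isOpen_ball.mem_nhds hz) hF
  have h2 := (hφ.differentiableAt (Metric.isOpen_ball.mem_nhds hz)).hasDerivAt
  rw [h1.deriv_eq]
  exact ((hasDerivAt_volterraU hf hg (hm hz)).comp z h2).deriv

theorem deriv2_compVolterraU (hφ : DifferentiableOn ℂ φ 𝔻) (hm : Set.MapsTo φ 𝔻 𝔻)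
    (hg : DifferentiableOn ℂ g 𝔻) {F f : ℂ → ℂ} (hf : DifferentiableOn ℂ f 𝔻)
    (hF : ∀ z ∈ 𝔻, F z = compVolterraU φ g f z) {z : ℂ} (hz : z ∈ 𝔻) :
    deriv (deriv F) z = symbolU φ g z * deriv f (φ z) + symbolW φ g z * f (φ z) := by
  have h1 : deriv F =ᶠ[nhds z] fun z => f (φ z) * deriv g (φ z) * deriv φ z :=
    Filter.eventuallyEq_of_mem (Metric.isOpen_ball.mem_nhds hz)
      fun w hw => deriv_compVolterraU hφ hm hg hf hF hw
  have d : ∀ {k : ℂ → ℂ}, DifferentiableOn ℂ k 𝔻 → ∀ {w}, w ∈ 𝔻 → HasDerivAt k (deriv k w) w :=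
    fun hk w hw => (hk.differentiableAt (Metric.isOpen_ball.mem_nhds hw)).hasDerivAt
  have h2 := d hφ hz
  have h3 := d (hφ.deriv Metric.isOpen_ball) hz
  have h4 := (d hf (hm hz)).comp z h2
  have h5 := (d (hg.deriv Metric.isOpen_ball) (hm hz)).comp z h2
  rw [h1.deriv_eq]
  have := ((h4.mul h5).mul h3).deriv
  simp only [Function.comp_def] at this
  refine Eq.trans this ?_
  simp only [symbolU, symbolW, Pi.mul_apply]
  ring

end Operator

/-! ### Growth estimates by integration along radii -/

theorem norm_lt_one_of_mem_disk {z : ℂ} (hz : z ∈ 𝔻) : ‖z‖ < 1 := by simpa using hz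

/-- Radial mean value inequality: a bound on the derivative in terms of the modulus can be
integrated along radii. -/
theorem norm_sub_radial_le {F : ℂ → ℂ} (hF : DifferentiableOn ℂ F 𝔻) {B b : ℝ → ℝ}
    (hB : ∀ s, 0 ≤ s → s < 1 → HasDerivAt B (b s) s) (hb : ∀ z ∈ 𝔻, ‖deriv F z‖ ≤ b ‖z‖)
    {z : ℂ} (hz : z ∈ 𝔻) {r : ℝ} (hr : r ∈ Set.Icc (0 : ℝ) 1) :
    ‖F z - F (r * z)‖ ≤ B ‖z‖ - B (r * ‖z‖) := by
  have hx := norm_lt_one_of_mem_disk hz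
  have hmem : ∀ t ∈ Set.Icc r 1, (t : ℂ) * z ∈ 𝔻 := fun t ht =>
    mul_mem_disk ⟨hr.1.trans ht.1, ht.2⟩ hz
  have hnorm : ∀ t ∈ Set.Icc r 1, ‖(t : ℂ) * z‖ = t * ‖z‖ := fun t ht => by
    rw [norm_mul, Complex.norm_real, Real.norm_eq_abs, abs_of_nonneg (hr.1.trans ht.1)]
  have hlt : ∀ t ∈ Set.Icc r 1, t * ‖z‖ < 1 := fun t ht => by
    nlinarith [norm_nonneg z, hr.1, ht.1, ht.2]
  have h1 : ∀ t ∈ Set.Icc r 1,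
      HasDerivAt (fun t : ℝ => F (t * z) - F (r * z)) (deriv F (t * z) * z) t := by
    intro t ht
    have h2 : HasDerivAt (fun t : ℝ => (t : ℂ) * z) z t := by
      simpa using (Complex.ofRealCLM.hasDerivAt (x := t)).mul_const z
    exact ((hF.differentiableAt
      (Metric.isOpen_ball.mem_nhds (hmem t ht))).hasDerivAt.comp t h2).sub_const _
  have h2 : ∀ t ∈ Set.Icc r 1,
      HasDerivAt (fun t : ℝ => B (t * ‖z‖) - B (r * ‖z‖)) (b (t * ‖z‖) * ‖z‖) t := by
    intro t ht
    have h3 : HasDerivAt (fun t : ℝ => t * ‖z‖) ‖z‖ t := by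
      simpa using (hasDerivAt_id t).mul_const ‖z‖
    exact ((hB _ (mul_nonneg (hr.1.trans ht.1) (norm_nonneg z)) (hlt t ht)).comp t h3).sub_const _
  have := image_norm_le_of_norm_deriv_right_le_deriv_boundary'
    (f := fun t : ℝ => F (t * z) - F (r * z)) (f' := fun t : ℝ => deriv F (t * z) * z)
    (B := fun t => B (t * ‖z‖) - B (r * ‖z‖)) (B' := fun t => b (t * ‖z‖) * ‖z‖)
    (a := r) (b := 1) (fun t ht => (h1 t ht).continuousAt.continuousWithinAt)
    (fun t ht => (h1 t (Set.Ico_subset_Icc_self ht)).hasDerivWithinAt) (by simp)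
    (fun t ht => (h2 t ht).continuousAt.continuousWithinAt)
    (fun t ht => (h2 t (Set.Ico_subset_Icc_self ht)).hasDerivWithinAt)
    (fun t ht => by
      have ht' := Set.Ico_subset_Icc_self ht
      rw [norm_mul]
      have := hb _ (hmem t ht')
      rw [hnorm t ht'] at this
      gcongr) (Set.right_mem_Icc.2 hr.2)
  simpa using this

section Growth

variable {F : ℂ → ℂ} {M γ : ℝ}

theorem norm_sub_radial_le_of_rpow (hF : DifferentiableOn ℂ F 𝔻) (hγ : γ ≠ 1)
    (hb : ∀ z ∈ 𝔻, ‖deriv F z‖ ≤ M * (1 - ‖z‖) ^ (-γ)) {z : ℂ} (hz : z ∈ 𝔻) {r : ℝ}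
    (hr : r ∈ Set.Icc (0 : ℝ) 1) :
    ‖F z - F (r * z)‖ ≤
      M / (γ - 1) * ((1 - ‖z‖) ^ (1 - γ) - (1 - r * ‖z‖) ^ (1 - γ)) := by
  have := norm_sub_radial_le hF (B := fun s => M / (γ - 1) * (1 - s) ^ (1 - γ))
    (b := fun s => M * (1 - s) ^ (-γ)) (fun s _ hs => ?_) hb hz hr
  · refine this.trans (le_of_eq ?_)
    ring
  · have h1 : HasDerivAt (fun s : ℝ => 1 - s) (-1) s := by
      simpa using (hasDerivAt_id s).const_sub 1
    have h2 := (h1.rpow_const (p := 1 - γ) (Or.inl (by linarith))).const_mul (M / (γ - 1))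
    refine h2.congr_deriv ?_
    have : γ - 1 ≠ 0 := sub_ne_zero.2 hγ
    rw [show 1 - γ - 1 = -γ by ring]
    field_simp
    ring

theorem norm_le_of_deriv_le_rpow (hF : DifferentiableOn ℂ F 𝔻) (hγ : 1 < γ) (hM : 0 ≤ M)
    (hb : ∀ z ∈ 𝔻, ‖deriv F z‖ ≤ M * (1 - ‖z‖) ^ (-γ)) {z : ℂ} (hz : z ∈ 𝔻) :
    ‖F z‖ ≤ ‖F 0‖ + M / (γ - 1) * (1 - ‖z‖) ^ (1 - γ) := by
  have h := norm_sub_radial_le_of_rpow hF hγ.ne' hb hz (r := 0) (by simp)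
  have h1 : 0 ≤ M / (γ - 1) := div_nonneg hM (by linarith)
  simp only [Complex.ofReal_zero, zero_mul, sub_zero, Real.one_rpow] at h
  have h2 := norm_le_norm_add_norm_sub' (F z) (F 0)
  nlinarith

theorem norm_le_of_deriv_le_inv (hF : DifferentiableOn ℂ F 𝔻)
    (hb : ∀ z ∈ 𝔻, ‖deriv F z‖ ≤ M * (1 - ‖z‖)⁻¹) {z : ℂ} (hz : z ∈ 𝔻) :
    ‖F z‖ ≤ ‖F 0‖ + M * Real.log (1 - ‖z‖)⁻¹ := by
  have h := norm_sub_radial_le hF (B := fun s => M * (-Real.log (1 - s)))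
    (b := fun s => M * (1 - s)⁻¹) (fun s _ hs => ?_) hb hz (r := 0) (by simp)
  · rw [Real.log_inv]
    simp only [Complex.ofReal_zero, zero_mul, sub_zero, Real.log_one] at h
    have h2 := norm_le_norm_add_norm_sub' (F z) (F 0)
    linarith
  · have h1 : HasDerivAt (fun s : ℝ => 1 - s) (-1) s := by
      simpa using (hasDerivAt_id s).const_sub 1
    have h2 := ((h1.log (by linarith)).neg).const_mul M
    refine h2.congr_deriv ?_
    have : 1 - s ≠ 0 := by linarith
    field_simp

/-- An integrable singularity of the derivative makes the dilations converge uniformly up to the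
boundary, since the bound does not involve `z`. -/
theorem norm_sub_dilation_le (hF : DifferentiableOn ℂ F 𝔻) (hγ : γ < 1) (hM : 0 ≤ M)
    (hb : ∀ z ∈ 𝔻, ‖deriv F z‖ ≤ M * (1 - ‖z‖) ^ (-γ)) {z : ℂ} (hz : z ∈ 𝔻) {r : ℝ}
    (hr : r ∈ Set.Icc (0 : ℝ) 1) (hγ0 : 0 ≤ γ) :
    ‖F z - F (r * z)‖ ≤ M / (1 - γ) * (1 - r) ^ (1 - γ) := by
  have h := norm_sub_radial_le_of_rpow hF hγ.ne hb hz hr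
  have hx := norm_lt_one_of_mem_disk hz
  have hx0 := norm_nonneg z
  -- Subadditivity of `t ↦ t ^ (1 - γ)`, applied to `1 - r‖z‖ = (1 - ‖z‖) + ‖z‖(1 - r)`.
  have h1 : (1 - r * ‖z‖) ^ (1 - γ) ≤ (1 - ‖z‖) ^ (1 - γ) + (‖z‖ * (1 - r)) ^ (1 - γ) := by
    have := Real.rpow_add_le_add_rpow (a := 1 - ‖z‖) (b := ‖z‖ * (1 - r)) (by linarith)
      (mul_nonneg hx0 (by linarith [hr.2])) (p := 1 - γ) (by linarith) (by linarith)
    rwa [show 1 - ‖z‖ + ‖z‖ * (1 - r) = 1 - r * ‖z‖ by ring] at this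
  have h2 : (‖z‖ * (1 - r)) ^ (1 - γ) ≤ (1 - r) ^ (1 - γ) := by
    have := hr.2
    exact Real.rpow_le_rpow (mul_nonneg hx0 (by linarith)) (by nlinarith) (by linarith)
  have h3 : 0 ≤ M / (1 - γ) := div_nonneg hM (by linarith)
  have h4 : M / (γ - 1) * ((1 - ‖z‖) ^ (1 - γ) - (1 - r * ‖z‖) ^ (1 - γ)) =
      M / (1 - γ) * ((1 - r * ‖z‖) ^ (1 - γ) - (1 - ‖z‖) ^ (1 - γ)) := by
    rw [show γ - 1 = -(1 - γ) by ring, div_neg]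
    ring
  rw [h4] at h
  exact h.trans (mul_le_mul_of_nonneg_left (by linarith) h3)

end Growth

/-! ### Local bounds and completeness -/

namespace ZygmundSpace

variable {α : ℝ}

theorem norm_deriv2_le (hα : 0 ≤ α) (f : ZygmundSpace α) {z : ℂ} (hz : z ∈ 𝔻) :
    ‖deriv (deriv f) z‖ ≤ ‖f‖ * (1 - ‖z‖) ^ (-α) := by
  have hx := norm_lt_one_of_mem_disk hz
  have h1 := weight_mul_norm_deriv2_le f hz
  have h2 : 0 < (1 - ‖z‖) ^ α := Real.rpow_pos_of_pos (by linarith) _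
  have h3 : (1 - ‖z‖) ^ α ≤ stdWeight α z :=
    Real.rpow_le_rpow (by linarith) (by nlinarith [norm_nonneg z]) hα
  rw [Real.rpow_neg (by linarith), ← div_eq_mul_inv, le_div_iff₀ h2, mul_comm]
  exact (mul_le_mul_of_nonneg_right h3 (norm_nonneg _)).trans h1

/-- On smaller disks, functions and their first two derivatives are controlled by the norm. -/
theorem exists_bound_of_norm_le (hα : 0 ≤ α) {ρ : ℝ} (hρ : ρ < 1) :
    ∃ C, 0 < C ∧ ∀ (f : ZygmundSpace α) (z : ℂ), ‖z‖ ≤ ρ →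
      ‖f z‖ ≤ C * ‖f‖ ∧ ‖deriv f z‖ ≤ C * ‖f‖ ∧ ‖deriv (deriv f) z‖ ≤ C * ‖f‖ := by
  have hA : 0 < (1 - ρ) ^ (-α) := Real.rpow_pos_of_pos (by linarith) _
  set A := (1 - ρ) ^ (-α) with hA'
  have h2 : ∀ (f : ZygmundSpace α) (z : ℂ), ‖z‖ ≤ ρ → ‖deriv (deriv f) z‖ ≤ A * ‖f‖ := by
    intro f z hz
    refine (norm_deriv2_le hα f (by simpa using hz.trans_lt hρ)).trans ?_
    rw [mul_comm, hA']
    exact mul_le_mul_of_nonneg_right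
      (Real.rpow_le_rpow_of_nonpos (by linarith) (by linarith) (by linarith)) (norm_nonneg f)
  have key : ∀ {F : ℂ → ℂ} {M : ℝ}, DifferentiableOn ℂ F 𝔻 → (∀ z, ‖z‖ ≤ ρ → ‖deriv F z‖ ≤ M) →
      ∀ z, ‖z‖ ≤ ρ → ‖F z‖ ≤ ‖F 0‖ + M := by
    intro F M hF hM z hz
    have hz0 : 0 ≤ ρ := (norm_nonneg z).trans hz
    have := (convex_closedBall (0 : ℂ) ρ).norm_image_sub_le_of_norm_deriv_le (f := F) (C := M)
      (x := 0) (y := z) (fun x hx => hF.differentiableAt (Metric.isOpen_ball.mem_nhds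
        (by simp at hx ⊢; linarith))) (fun x hx => hM x (by simpa using hx))
      (by simpa using hz0) (by simpa using hz)
    have hM0 : 0 ≤ M := (norm_nonneg _).trans (hM z hz)
    rw [sub_zero] at this
    have h3 := norm_le_norm_add_norm_sub' (F z) (F 0)
    nlinarith [norm_nonneg z]
  have h1 : ∀ (f : ZygmundSpace α) (z : ℂ), ‖z‖ ≤ ρ → ‖deriv f z‖ ≤ (1 + A) * ‖f‖ := by
    intro f z hz
    have := key (f.differentiableOn.deriv Metric.isOpen_ball) (h2 f) z hz
    linarith [norm_deriv_zero_le f]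
  refine ⟨2 + A, by linarith, fun f z hz => ⟨?_, ?_, ?_⟩⟩
  · have := key f.differentiableOn (h1 f) z hz
    linarith [norm_apply_zero_le f]
  · linarith [h1 f z hz, norm_nonneg f]
  · linarith [h2 f z hz, norm_nonneg f]

/-- Needed for the target space, so that norm limits of compact operators are compact. Norm-Cauchy
sequences converge locally uniformly, and so do their derivatives. -/
theorem completeSpace (hα : 0 ≤ α) : CompleteSpace (ZygmundSpace α) := by
  refine Metric.complete_of_cauchySeq_tendsto fun u hu => ?_
  have hC : ∀ ε > 0, ∃ N, ∀ m ≥ N, ∀ n ≥ N, ‖u m - u n‖ < ε := by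
    intro ε hε
    obtain ⟨N, hN⟩ := Metric.cauchySeq_iff.1 hu ε hε
    exact ⟨N, fun m hm n hn => by simpa [dist_eq_norm] using hN m hm n hn⟩
  have hpt : ∀ z ∈ 𝔻, ∃ l, Filter.Tendsto (fun n => u n z) Filter.atTop (nhds l) := by
    intro z hz
    obtain ⟨C, hC0, hCb⟩ := exists_bound_of_norm_le hα (norm_lt_one_of_mem_disk hz)
    refine cauchySeq_tendsto_of_complete (Metric.cauchySeq_iff.2 fun ε hε => ?_)
    obtain ⟨N, hN⟩ := hC (ε / C) (by positivity)
    refine ⟨N, fun m hm n hn => ?_⟩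
    have h1 := (hCb (u m - u n) z le_rfl).1
    have h2 := hN m hm n hn
    rw [lt_div_iff₀ hC0] at h2
    rw [dist_eq_norm, ← sub_apply]
    linarith
  choose! l hl using hpt
  let F : ℂ → ℂ := Set.indicator 𝔻 l
  have hF : ∀ z ∈ 𝔻, Filter.Tendsto (fun n => u n z) Filter.atTop (nhds (F z)) := by
    intro z hz
    simpa [F, Set.indicator_of_mem hz] using hl z hz
  have hloc : TendstoLocallyUniformlyOn (fun n => (u n : ℂ → ℂ)) F Filter.atTop 𝔻 := by
    rw [Metric.tendstoLocallyUniformlyOn_iff]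
    intro ε hε z hz
    have hz1 := norm_lt_one_of_mem_disk hz
    obtain ⟨C, hC0, hCb⟩ := exists_bound_of_norm_le hα (ρ := (1 + ‖z‖) / 2) (by linarith)
    refine ⟨𝔻 ∩ Metric.ball 0 ((1 + ‖z‖) / 2), Filter.inter_mem self_mem_nhdsWithin
      (mem_nhdsWithin_of_mem_nhds (Metric.isOpen_ball.mem_nhds (by simp; linarith))), ?_⟩
    obtain ⟨N, hN⟩ := hC (ε / 2 / C) (by positivity)
    filter_upwards [Filter.eventually_ge_atTop N] with n hn y hy
    have h1 : ∀ᶠ m in Filter.atTop, dist (u m y) (u n y) ≤ ε / 2 := by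
      filter_upwards [Filter.eventually_ge_atTop N] with m hm
      have h1 := (hCb (u m - u n) y (by simpa using (Metric.mem_ball.1 hy.2).le)).1
      have h2 := hN m hm n hn
      rw [lt_div_iff₀ hC0] at h2
      rw [dist_eq_norm, ← sub_apply]
      linarith
    have := le_of_tendsto ((hF y hy.1).dist tendsto_const_nhds) h1
    linarith
  have hdiff : ∀ᶠ n in Filter.atTop, DifferentiableOn ℂ (u n : ℂ → ℂ) 𝔻 :=
    Filter.Eventually.of_forall fun n => (u n).differentiableOn
  have hFd := hloc.differentiableOn hdiff Metric.isOpen_ball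
  have hloc1 := hloc.deriv hdiff Metric.isOpen_ball
  have hloc2 := hloc1.deriv (Filter.Eventually.of_forall fun n =>
    (u n).differentiableOn.deriv Metric.isOpen_ball) Metric.isOpen_ball
  have hF1 : ∀ z ∈ 𝔻, Filter.Tendsto (fun n => deriv (u n) z) Filter.atTop (nhds (deriv F z)) :=
    fun z hz => hloc1.tendsto_at hz
  have hF2 : ∀ z ∈ 𝔻, Filter.Tendsto (fun n => deriv (deriv (u n)) z) Filter.atTop
      (nhds (deriv (deriv F) z)) := fun z hz => hloc2.tendsto_at hz
  -- Letting `m → ∞` pointwise in the Cauchy estimates gives uniform control of each of the three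
  -- parts of the norm.
  have hlim : ∀ ε > 0, ∃ N, ∀ n ≥ N, ‖F 0 - u n 0‖ ≤ ε ∧ ‖deriv F 0 - deriv (u n) 0‖ ≤ ε ∧
      ∀ z ∈ 𝔻, stdWeight α z * ‖deriv (deriv F) z - deriv (deriv (u n)) z‖ ≤ ε := by
    intro ε hε
    have h0 : (0 : ℂ) ∈ 𝔻 := by simp
    obtain ⟨N, hN⟩ := hC ε hε
    refine ⟨N, fun n hn => ⟨?_, ?_, fun z hz => ?_⟩⟩
    · refine le_of_tendsto ((hF 0 h0).sub tendsto_const_nhds).norm ?_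
      filter_upwards [Filter.eventually_ge_atTop N] with m hm
      exact (norm_apply_zero_le (u m - u n)).trans (hN m hm n hn).le
    · refine le_of_tendsto ((hF1 0 h0).sub tendsto_const_nhds).norm ?_
      filter_upwards [Filter.eventually_ge_atTop N] with m hm
      rw [← deriv_sub' _ _ h0]
      exact (norm_deriv_zero_le (u m - u n)).trans (hN m hm n hn).le
    · refine le_of_tendsto (((hF2 z hz).sub tendsto_const_nhds).norm.const_mul _) ?_
      filter_upwards [Filter.eventually_ge_atTop N] with m hm
      rw [← deriv2_sub _ _ hz]
      exact (weight_mul_norm_deriv2_le (u m - u n) hz).trans (hN m hm n hn).le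
  have hmem : F ∈ zygmundSubmodule α := by
    refine ⟨hFd, fun z hz => Set.indicator_of_notMem hz _, ?_⟩
    obtain ⟨N, hN⟩ := hlim 1 one_pos
    refine ⟨‖u N‖ + 1, fun z hz => ?_⟩
    have h1 := (hN N le_rfl).2.2 z hz
    have h2 := weight_mul_norm_deriv2_le (u N) hz
    have h3 := norm_le_norm_add_norm_sub' (deriv (deriv F) z) (deriv (deriv (u N)) z)
    nlinarith [weight_pos α hz]
  let f : ZygmundSpace α := ⟨F, hmem⟩
  refine ⟨f, Metric.tendsto_atTop.2 fun ε hε => ?_⟩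
  obtain ⟨N, hN⟩ := hlim (ε / 4) (by positivity)
  refine ⟨N, fun n hn => ?_⟩
  obtain ⟨h1, h2, h3⟩ := hN n hn
  rw [dist_comm, dist_eq_norm]
  have := norm_le_of_forall (f - u n) (A := ε / 4) (B := ε / 4) (C := ε / 4) h1
    (by rw [deriv_sub' _ _ (by simp)]; exact h2) (fun z hz => by
      rw [deriv2_sub _ _ hz]; exact h3 z hz)
  linarith

end ZygmundSpace

/-! ### Finite-rank approximation of dilations -/

/-- Geometric bound for the remainder of the Taylor series at the origin. -/
theorem norm_sub_taylor_sum_le {F : ℂ → ℂ} (hF : DifferentiableOn ℂ F 𝔻) {r R M : ℝ}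
    (hr : 0 ≤ r) (hrR : r < R) (hR : R < 1) (hM : ∀ z, ‖z‖ ≤ R → ‖F z‖ ≤ M) {z : ℂ}
    (hz : ‖z‖ ≤ r) (N : ℕ) :
    ‖F z - ∑ n ∈ Finset.range N, (n.factorial : ℂ)⁻¹ * z ^ n * iteratedDeriv n F 0‖ ≤
      M * (r / R) ^ N / (1 - r / R) := by
  have hR0 : 0 < R := hr.trans_lt hrR
  have hz1 : z ∈ 𝔻 := by simp; linarith
  have hs := Complex.hasSum_taylorSeries_on_ball hF hz1
  simp only [sub_zero, smul_eq_mul, ← mul_assoc] at hs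
  have hq0 : 0 ≤ r / R := by positivity
  have hq1 : r / R < 1 := (div_lt_one hR0).2 hrR
  have hM0 : 0 ≤ M := (norm_nonneg _).trans (hM 0 (by simpa using hR0.le))
  -- Cauchy's estimates on the circle of radius `R`.
  have hterm : ∀ n, ‖(n.factorial : ℂ)⁻¹ * z ^ n * iteratedDeriv n F 0‖ ≤ M * (r / R) ^ n := by
    intro n
    have hd : DiffContOnCl ℂ F (Metric.ball 0 R) := by
      refine DifferentiableOn.diffContOnCl ?_
      rw [closure_ball _ hR0.ne']
      exact hF.mono (Metric.closedBall_subset_ball hR)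
    have h1 := Complex.norm_iteratedDeriv_le_of_forall_mem_sphere_norm_le n hR0 hd
      (fun w hw => hM w (by simpa using (mem_sphere_zero_iff_norm.1 hw).le))
    have hf : (0 : ℝ) < n.factorial := by exact_mod_cast n.factorial_pos
    rw [norm_mul, norm_mul, norm_inv, Complex.norm_natCast, norm_pow]
    calc (n.factorial : ℝ)⁻¹ * ‖z‖ ^ n * ‖iteratedDeriv n F 0‖
        ≤ (n.factorial : ℝ)⁻¹ * r ^ n * (n.factorial * M / R ^ n) := by gcongr
      _ = M * (r / R) ^ n := by rw [div_pow]; field_simp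
  have htail := (hasSum_nat_add_iff' N).2 hs
  have hgeo : HasSum (fun n => M * (r / R) ^ (n + N)) (M * (r / R) ^ N * (1 - r / R)⁻¹) := by
    have h := (hasSum_geometric_of_lt_one hq0 hq1).mul_left (M * (r / R) ^ N)
    have h' : (fun n => M * (r / R) ^ (n + N)) = fun n => M * (r / R) ^ N * (r / R) ^ n := by
      funext n
      rw [pow_add]
      ring
    rwa [h']
  rw [div_eq_mul_inv, ← htail.tsum_eq]
  exact tsum_of_norm_bounded hgeo fun n => hterm (n + N)

namespace ZygmundSpace

open Polynomial

variable {α : ℝ}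

/-- The functionals `f ↦ f⁽ⁿ⁾(0)`. -/
noncomputable def iteratedDerivL (hα : 0 ≤ α) (n : ℕ) : ZygmundSpace α →L[ℂ] ℂ :=
  LinearMap.mkContinuousOfExistsBound
    { toFun := fun f => iteratedDeriv n f 0
      map_add' := fun f g => iteratedDeriv_add_apply f g n
      map_smul' := fun c f => iteratedDeriv_smul_apply c f n } <| by
    obtain ⟨C, hC0, hC⟩ := exists_bound_of_norm_le hα (ρ := 1 / 2) (by norm_num)
    refine ⟨n.factorial * C / (1 / 2) ^ n, fun f => ?_⟩
    have hd : DiffContOnCl ℂ f (Metric.ball 0 (1 / 2)) := by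
      refine DifferentiableOn.diffContOnCl ?_
      rw [closure_ball _ (by norm_num)]
      exact f.differentiableOn.mono (Metric.closedBall_subset_ball (by norm_num))
    refine (Complex.norm_iteratedDeriv_le_of_forall_mem_sphere_norm_le n (by norm_num) hd
      (fun w hw => (hC f w (by simpa using (mem_sphere_zero_iff_norm.1 hw).le)).1)).trans
      (le_of_eq ?_)
    ring

theorem iteratedDerivL_apply (hα : 0 ≤ α) (n : ℕ) (f : ZygmundSpace α) :
    iteratedDerivL hα n f = iteratedDeriv n f 0 := rfl

/-- The `N`-th Taylor polynomial of the dilation `z ↦ f (r z)`. -/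
noncomputable def taylorOp (hα : 0 ≤ α) (r : ℝ) (N : ℕ) : ZygmundSpace α →L[ℂ] ZygmundSpace α :=
  ∑ n ∈ Finset.range N, (iteratedDerivL hα n).smulRight
    (ofPoly hα (C ((n.factorial : ℂ)⁻¹ * (r : ℂ) ^ n) * X ^ n))

theorem isCompactOperator_taylorOp (hα : 0 ≤ α) (r : ℝ) (N : ℕ) :
    IsCompactOperator (taylorOp hα r N) := by
  have h : taylorOp hα r N ∈
      compactOperator (RingHom.id ℂ) (ZygmundSpace α) (ZygmundSpace α) := by
    refine sum_mem fun n _ => ?_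
    have h1 : IsCompactOperator (iteratedDerivL hα n) :=
      isCompactOperator_of_locallyCompactSpace_dom (iteratedDerivL hα n)
    exact h1.clm_comp (ContinuousLinearMap.toSpanSingleton ℂ
      (ofPoly hα (C ((n.factorial : ℂ)⁻¹ * (r : ℂ) ^ n) * X ^ n)))
  exact h

theorem taylorOp_apply (hα : 0 ≤ α) (r : ℝ) (N : ℕ) (f : ZygmundSpace α) {z : ℂ} (hz : z ∈ 𝔻) :
    taylorOp hα r N f z =
      ∑ n ∈ Finset.range N, (n.factorial : ℂ)⁻¹ * (r * z) ^ n * iteratedDeriv n f 0 := by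
  rw [taylorOp, _root_.sum_apply, sum_apply]
  refine Finset.sum_congr rfl fun n _ => ?_
  rw [ContinuousLinearMap.smulRight_apply, smul_apply, ofPoly_apply hα _ hz, iteratedDerivL_apply]
  simp only [eval_mul, eval_C, eval_pow, eval_X]
  ring

theorem deriv_taylorOp (hα : 0 ≤ α) (r : ℝ) (N : ℕ) (f : ZygmundSpace α) {z : ℂ} (hz : z ∈ 𝔻) :
    deriv (taylorOp hα r (N + 1) f) z =
      r * ∑ n ∈ Finset.range N,
        (n.factorial : ℂ)⁻¹ * (r * z) ^ n * iteratedDeriv n (deriv f) 0 := by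
  have h1 : taylorOp hα r (N + 1) f =ᶠ[nhds z] fun z => ∑ n ∈ Finset.range (N + 1),
      (n.factorial : ℂ)⁻¹ * (r * z) ^ n * iteratedDeriv n f 0 :=
    Filter.eventuallyEq_of_mem (Metric.isOpen_ball.mem_nhds hz) fun w hw =>
      taylorOp_apply hα r _ f hw
  have h2 : ∀ n ∈ Finset.range (N + 1), HasDerivAt
      (fun z : ℂ => (n.factorial : ℂ)⁻¹ * (r * z) ^ n * iteratedDeriv n f 0)
      ((n.factorial : ℂ)⁻¹ * (n * (r * z) ^ (n - 1) * r) * iteratedDeriv n f 0) z := by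
    intro n _
    have h3 : HasDerivAt (fun z : ℂ => (r : ℂ) * z) r z := by
      simpa using (hasDerivAt_id z).const_mul (r : ℂ)
    exact ((h3.pow n).const_mul _).mul_const _
  rw [h1.deriv_eq, (HasDerivAt.fun_sum h2).deriv, Finset.sum_range_succ', Finset.mul_sum]
  simp only [Nat.cast_zero, zero_mul, mul_zero, add_zero, iteratedDeriv_succ']
  refine Finset.sum_congr rfl fun n _ => ?_
  have h4 : (n.factorial : ℂ) ≠ 0 := by exact_mod_cast n.factorial_ne_zero
  have h5 : (n : ℂ) + 1 ≠ 0 := by exact_mod_cast n.succ_ne_zero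
  rw [Nat.factorial_succ]
  push_cast
  field_simp

/-- A dilation sees `f` only on the disk of radius `r < 1`, where the Taylor series of `f` and `f'`
converge at a geometric rate uniform over the unit ball of the space. -/
theorem exists_taylorOp_approx (hα : 0 ≤ α) {r : ℝ} (hr0 : 0 ≤ r) (hr1 : r < 1) {ε : ℝ}
    (hε : 0 < ε) : ∃ N, ∀ (f : ZygmundSpace α), ∀ z ∈ 𝔻,
      ‖f (r * z) - taylorOp hα r N f z‖ ≤ ε * ‖f‖ ∧
      ‖r * deriv f (r * z) - deriv (taylorOp hα r N f) z‖ ≤ ε * ‖f‖ := by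
  obtain ⟨R, hrR, hR1⟩ := exists_between hr1
  have hR0 : 0 < R := hr0.trans_lt hrR
  obtain ⟨C, hC0, hC⟩ := exists_bound_of_norm_le hα hR1
  have hq0 : 0 ≤ r / R := by positivity
  have hq1 : r / R < 1 := (div_lt_one hR0).2 hrR
  have hlim : Filter.Tendsto (fun N => C * (r / R) ^ N / (1 - r / R)) Filter.atTop (nhds 0) := by
    simpa using ((tendsto_pow_atTop_nhds_zero_of_lt_one hq0 hq1).const_mul C).div_const
      (1 - r / R)
  obtain ⟨N, hN⟩ := Filter.eventually_atTop.1 (hlim.eventually (gt_mem_nhds hε))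
  have hz' : ∀ z ∈ 𝔻, ‖(r : ℂ) * z‖ ≤ r := by
    intro z hz
    have := norm_lt_one_of_mem_disk hz
    rw [norm_mul, Complex.norm_real, Real.norm_eq_abs, abs_of_nonneg hr0]
    nlinarith
  have hb : ∀ n ≥ N, ∀ f : ZygmundSpace α, C * ‖f‖ * (r / R) ^ n / (1 - r / R) ≤ ε * ‖f‖ := by
    intro n hn f
    have := mul_le_mul_of_nonneg_right (hN n hn).le (norm_nonneg f)
    refine le_trans (le_of_eq ?_) this
    ring
  -- Differentiation lowers the number of Taylor terms by one, so `N + 1` terms of `f` leave `N`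
  -- terms of `f'`.
  refine ⟨N + 1, fun f z hz => ⟨?_, ?_⟩⟩
  · rw [taylorOp_apply hα r _ f hz]
    exact (norm_sub_taylor_sum_le f.differentiableOn hr0 hrR hR1 (fun w hw => (hC f w hw).1)
      (hz' z hz) _).trans (hb _ (by omega) f)
  · rw [deriv_taylorOp hα r _ f hz, ← mul_sub, norm_mul, Complex.norm_real, Real.norm_eq_abs,
      abs_of_nonneg hr0]
    have h1 := (norm_sub_taylor_sum_le (f.differentiableOn.deriv Metric.isOpen_ball) hr0 hrR hR1
      (fun w hw => (hC f w hw).2.1) (hz' z hz) _).trans (hb N le_rfl f)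
    exact (mul_le_of_le_one_left (norm_nonneg _) hr1.le).trans h1

theorem eventually_norm_sub_dilation_le (hα : 0 ≤ α) {ρ : ℝ} (hρ : ρ < 1) {η : ℝ} (hη : 0 < η) :
    ∀ᶠ r : ℝ in nhdsWithin 1 (Set.Iio 1), ∀ (f : ZygmundSpace α) (z : ℂ), ‖z‖ ≤ ρ →
      ‖f z - f (r * z)‖ ≤ ‖f‖ * η ∧ ‖deriv f z - r * deriv f (r * z)‖ ≤ ‖f‖ * η := by
  obtain ⟨C, hC0, hC⟩ := exists_bound_of_norm_le hα hρ
  have h1 : ∀ᶠ r : ℝ in nhdsWithin 1 (Set.Iio 1), 2 * C * (1 - r) < η := by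
    have : Filter.Tendsto (fun r : ℝ => 2 * C * (1 - r)) (nhds 1) (nhds 0) := by
      have : Continuous (fun r : ℝ => 2 * C * (1 - r)) := by fun_prop
      simpa using this.tendsto 1
    exact (this.mono_left nhdsWithin_le_nhds).eventually (gt_mem_nhds hη)
  have h2 : ∀ᶠ r : ℝ in nhdsWithin 1 (Set.Iio 1), r ∈ Set.Ioo 0 1 :=
    Ioo_mem_nhdsLT one_pos
  filter_upwards [h1, h2] with r hr1 hr f z hz
  have hz0 := norm_nonneg z
  have hrz : ‖(r : ℂ) * z‖ ≤ ρ := by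
    rw [norm_mul, Complex.norm_real, Real.norm_eq_abs, abs_of_pos hr.1]
    nlinarith [hr.2]
  have key : ∀ {F : ℂ → ℂ} {M : ℝ}, DifferentiableOn ℂ F 𝔻 → (∀ z, ‖z‖ ≤ ρ → ‖deriv F z‖ ≤ M) →
      ‖F z - F (r * z)‖ ≤ M * (1 - r) := by
    intro F M hF hM
    have := (convex_closedBall (0 : ℂ) ρ).norm_image_sub_le_of_norm_deriv_le (f := F) (C := M)
      (x := r * z) (y := z) (fun x hx => hF.differentiableAt (Metric.isOpen_ball.mem_nhds
        (by simp at hx ⊢; linarith))) (fun x hx => hM x (by simpa using hx))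
      (by simpa using hrz) (by simpa using hz)
    have hM0 : 0 ≤ M := (norm_nonneg _).trans (hM z hz)
    refine this.trans (mul_le_mul_of_nonneg_left ?_ hM0)
    rw [show z - r * z = ((1 - r : ℝ) : ℂ) * z by push_cast; ring, norm_mul, Complex.norm_real,
      Real.norm_eq_abs, abs_of_pos (by linarith [hr.2])]
    nlinarith [hr.2]
  have hf := norm_nonneg f
  have hr2 := hr.2
  constructor
  · have := key f.differentiableOn (fun w hw => (hC f w hw).2.1)
    nlinarith
  · have h3 := key (f.differentiableOn.deriv Metric.isOpen_ball) (fun w hw => (hC f w hw).2.2)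
    have h4 := (hC f _ hrz).2.1
    have h5 : deriv f z - r * deriv f (r * z) =
        (deriv f z - deriv f (r * z)) + ((1 - r : ℝ) : ℂ) * deriv f (r * z) := by
      push_cast; ring
    have h6 : ‖((1 - r : ℝ) : ℂ) * deriv f (r * z)‖ ≤ (1 - r) * (C * ‖f‖) := by
      rw [norm_mul, Complex.norm_real, Real.norm_eq_abs, abs_of_pos (by linarith)]
      exact mul_le_mul_of_nonneg_left h4 (by linarith)
    rw [h5]
    refine (norm_add_le _ _).trans ?_
    nlinarith

/-- `f - f(r ·)` and its derivative are bounded, asymptotically as `r → 1`, by `G₀ ‖f‖` and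
`G₁ ‖f‖` on the disk. -/
def DilationBound (α : ℝ) (G₀ G₁ : ℝ → ℝ) : Prop :=
  ∀ η > 0, ∀ᶠ r : ℝ in nhdsWithin 1 (Set.Iio 1), ∀ (f : ZygmundSpace α), ∀ z ∈ 𝔻,
    ‖f z - f (r * z)‖ ≤ ‖f‖ * (η + G₀ ‖z‖) ∧
    ‖deriv f z - r * deriv f (r * z)‖ ≤ ‖f‖ * (η + G₁ ‖z‖)

/-- Half of the error `η` is spent on replacing `f` by `f(r ·)` with `r` close to `1`, the other
half on replacing `f(r ·)` by a Taylor polynomial. -/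
theorem DilationBound.exists_compact (hα : 0 ≤ α) {G₀ G₁ : ℝ → ℝ} (hG : DilationBound α G₀ G₁)
    {ρ : ℝ} (hρ : ρ < 1) {η : ℝ} (hη : 0 < η) :
    ∃ L : ZygmundSpace α →L[ℂ] ZygmundSpace α, IsCompactOperator L ∧
      ∀ (f : ZygmundSpace α), ∀ z ∈ 𝔻,
        (‖(f - L f) z‖ ≤ ‖f‖ * (η + G₀ ‖z‖) ∧
          ‖deriv (f - L f : ZygmundSpace α) z‖ ≤ ‖f‖ * (η + G₁ ‖z‖)) ∧
        (‖z‖ ≤ ρ → ‖(f - L f) z‖ ≤ ‖f‖ * η ∧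
          ‖deriv (f - L f : ZygmundSpace α) z‖ ≤ ‖f‖ * η) := by
  have h2 : ∀ᶠ r : ℝ in nhdsWithin 1 (Set.Iio 1), r ∈ Set.Ioo 0 1 :=
    Ioo_mem_nhdsLT one_pos
  obtain ⟨r, h1, h2, h3⟩ := ((hG (η / 2) (by positivity)).and
    ((eventually_norm_sub_dilation_le hα hρ (half_pos hη)).and h2)).exists
  obtain ⟨N, hN⟩ := exists_taylorOp_approx hα h3.1.le h3.2 (half_pos hη)
  refine ⟨taylorOp hα r N, isCompactOperator_taylorOp hα r N, fun f z hz => ?_⟩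
  obtain ⟨h4, h5⟩ := hN f z hz
  obtain ⟨h6, h7⟩ := h1 f z hz
  have h8 := norm_sub_le_norm_sub_add_norm_sub (f z) (f (r * z)) (taylorOp hα r N f z)
  have h9 := norm_sub_le_norm_sub_add_norm_sub (deriv f z) (r * deriv f (r * z))
    (deriv (taylorOp hα r N f) z)
  rw [deriv_sub' _ _ hz, sub_apply]
  refine ⟨⟨by linarith, by linarith⟩, fun hzρ => ?_⟩
  obtain ⟨h10, h11⟩ := h2 f z hzρ
  exact ⟨by linarith, by linarith⟩

end ZygmundSpace

/-! ### Growth of functions and dilation bounds in each range of the exponent -/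

namespace ZygmundSpace

variable {α : ℝ}

theorem one_le_rpow_neg {x s : ℝ} (hx0 : 0 ≤ x) (hx : x < 1) (hs : 0 ≤ s) :
    1 ≤ (1 - x) ^ (-s) :=
  Real.one_le_rpow_of_pos_of_le_one_of_nonpos (by linarith) (by linarith) (by linarith)

/-- The exponent `γ` may exceed `α - 1`; this slack covers `α ≤ 1`, where a positive power is not
sharp but suffices for integrating once more. -/
theorem norm_deriv_le_rpow (hα : 0 ≤ α) {γ : ℝ} (hγ : 0 < γ) (h : α ≤ 1 + γ)
    (f : ZygmundSpace α) {z : ℂ} (hz : z ∈ 𝔻) :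
    ‖deriv f z‖ ≤ (1 + 1 / γ) * ‖f‖ * (1 - ‖z‖) ^ (-γ) := by
  have h1 := norm_le_of_deriv_le_rpow (f.differentiableOn.deriv Metric.isOpen_ball)
    (γ := 1 + γ) (M := ‖f‖) (by linarith) (norm_nonneg f) (fun w hw => by
      have hw1 := norm_lt_one_of_mem_disk hw
      refine (norm_deriv2_le hα f hw).trans (mul_le_mul_of_nonneg_left ?_ (norm_nonneg f))
      exact Real.rpow_le_rpow_of_exponent_ge (by linarith) (by linarith [norm_nonneg w])
        (by linarith)) hz
  rw [show 1 + γ - 1 = γ by ring, show 1 - (1 + γ) = -γ by ring] at h1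
  have h2 := one_le_rpow_neg (norm_nonneg z) (norm_lt_one_of_mem_disk hz) hγ.le
  have h3 := norm_deriv_zero_le f
  have h4 := mul_le_mul_of_nonneg_left h2 (norm_nonneg f)
  have h5 : (1 + 1 / γ) * ‖f‖ * (1 - ‖z‖) ^ (-γ) =
    ‖f‖ * (1 - ‖z‖) ^ (-γ) + ‖f‖ / γ * (1 - ‖z‖) ^ (-γ) := by ring
  linarith

theorem norm_deriv_le_log (f : ZygmundSpace 1) {z : ℂ} (hz : z ∈ 𝔻) :
    ‖deriv f z‖ ≤ ‖f‖ * (1 + Real.log (1 - ‖z‖)⁻¹) := by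
  have h1 := norm_le_of_deriv_le_inv (f.differentiableOn.deriv Metric.isOpen_ball)
    (M := ‖f‖) (fun w hw => by
      simpa [Real.rpow_neg_one] using norm_deriv2_le zero_le_one f hw) hz
  linarith [norm_deriv_zero_le f]

theorem norm_apply_le_log (f : ZygmundSpace 2) {z : ℂ} (hz : z ∈ 𝔻) :
    ‖f z‖ ≤ ‖f‖ * (1 + 2 * Real.log (1 - ‖z‖)⁻¹) := by
  have h1 := norm_le_of_deriv_le_inv f.differentiableOn (M := 2 * ‖f‖) (fun w hw => by
      have := norm_deriv_le_rpow (γ := 1) zero_le_two one_pos (by norm_num) f hw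
      rw [Real.rpow_neg_one] at this
      refine this.trans (le_of_eq ?_)
      norm_num) hz
  linarith [norm_apply_zero_le f]

theorem norm_apply_le_rpow (hα : 2 < α) (f : ZygmundSpace α) {z : ℂ} (hz : z ∈ 𝔻) :
    ‖f z‖ ≤ (1 + (1 + 1 / (α - 1)) / (α - 2)) * ‖f‖ * (1 - ‖z‖) ^ (-(α - 2)) := by
  have h0 : 0 ≤ 1 + 1 / (α - 1) := by
    have : 0 < α - 1 := by linarith
    positivity
  have h1 := norm_le_of_deriv_le_rpow f.differentiableOn (γ := α - 1)
    (M := (1 + 1 / (α - 1)) * ‖f‖) (by linarith) (by positivity)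
    (fun w hw => norm_deriv_le_rpow (by linarith) (by linarith) (by linarith) f hw) hz
  rw [show α - 1 - 1 = α - 2 by ring, show 1 - (α - 1) = -(α - 2) by ring] at h1
  have h2 := one_le_rpow_neg (norm_nonneg z) (norm_lt_one_of_mem_disk hz)
    (s := α - 2) (by linarith)
  have h3 := norm_apply_zero_le f
  have h4 := mul_le_mul_of_nonneg_left h2 (norm_nonneg f)
  have h5 : (1 + (1 + 1 / (α - 1)) / (α - 2)) * ‖f‖ * (1 - ‖z‖) ^ (-(α - 2)) =
    ‖f‖ * (1 - ‖z‖) ^ (-(α - 2)) +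
      (1 + 1 / (α - 1)) * ‖f‖ / (α - 2) * (1 - ‖z‖) ^ (-(α - 2)) := by ring
  linarith

theorem eventually_mul_rpow_le {C s η : ℝ} (hs : 0 < s) (hη : 0 < η) :
    ∀ᶠ r : ℝ in nhdsWithin 1 (Set.Iio 1), C * (1 - r) ^ s ≤ η := by
  have h : Filter.Tendsto (fun r : ℝ => C * (1 - r) ^ s) (nhds 1) (nhds 0) := by
    have hc : Continuous (fun r : ℝ => C * (1 - r) ^ s) :=
      continuous_const.mul ((continuous_const.sub continuous_id).rpow_const fun _ => Or.inr hs.le)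
    simpa [Real.zero_rpow hs.ne'] using hc.tendsto 1
  filter_upwards [(h.mono_left nhdsWithin_le_nhds).eventually (gt_mem_nhds hη)] with r hr
  exact hr.le

theorem eventually_mem_Ioo : ∀ᶠ r : ℝ in nhdsWithin 1 (Set.Iio 1), r ∈ Set.Ioo 0 1 :=
  Ioo_mem_nhdsLT one_pos

/-- For `α < 2` the dilations converge uniformly on the disk. -/
theorem eventually_norm_sub_le (hα : 0 ≤ α) (hα2 : α < 2) {η : ℝ} (hη : 0 < η) :
    ∀ᶠ r : ℝ in nhdsWithin 1 (Set.Iio 1), ∀ (f : ZygmundSpace α), ∀ z ∈ 𝔻,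
      ‖f z - f (r * z)‖ ≤ ‖f‖ * η := by
  -- Any exponent in `(0, 1)` that is at least `α - 1` would do; `1 / 2` keeps it positive when `α ≤
  -- 1`.
  set γ := max (1 / 2) (α - 1) with hγ
  have hγ0 : 0 < γ := lt_max_of_lt_left (by norm_num)
  have hγ1 : γ < 1 := max_lt (by norm_num) (by linarith)
  have hγα : α ≤ 1 + γ := by linarith [le_max_right (1 / 2) (α - 1)]
  filter_upwards [eventually_mul_rpow_le (C := (1 + 1 / γ) / (1 - γ)) (s := 1 - γ)
    (by linarith) hη, eventually_mem_Ioo] with r hr hr' f z hz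
  have := norm_sub_dilation_le f.differentiableOn hγ1 (M := (1 + 1 / γ) * ‖f‖) (by positivity)
    (fun w hw => norm_deriv_le_rpow hα hγ0 hγα f hw) hz ⟨hr'.1.le, hr'.2.le⟩ hγ0.le
  have h2 := mul_le_mul_of_nonneg_left hr (norm_nonneg f)
  refine this.trans (le_trans (le_of_eq ?_) h2)
  ring

/-- For `α < 1` the derivatives of the dilations converge uniformly on the disk. -/
theorem eventually_norm_deriv_sub_le (hα : 0 ≤ α) (hα1 : α < 1) {η : ℝ} (hη : 0 < η) :
    ∀ᶠ r : ℝ in nhdsWithin 1 (Set.Iio 1), ∀ (f : ZygmundSpace α), ∀ z ∈ 𝔻,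
      ‖deriv f z - r * deriv f (r * z)‖ ≤ ‖f‖ * η := by
  have hα' : 0 < 1 - α := by linarith
  filter_upwards [eventually_mul_rpow_le (C := 1 / (1 - α)) (s := 1 - α) hα' (half_pos hη),
    eventually_mul_rpow_le (C := 1 + 1 / (1 - α)) (s := 1) one_pos (half_pos hη),
    eventually_mem_Ioo] with r hr hr2 hr' f z hz
  have key : ∀ r ∈ Set.Icc (0 : ℝ) 1, ∀ w ∈ 𝔻, ‖deriv f w - deriv f (r * w)‖ ≤
      ‖f‖ / (1 - α) * (1 - r) ^ (1 - α) := fun r hr w hw =>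
    norm_sub_dilation_le (f.differentiableOn.deriv Metric.isOpen_ball) hα1 (norm_nonneg f)
      (fun w hw => norm_deriv2_le hα f hw) hw hr hα
  have h1 := key r ⟨hr'.1.le, hr'.2.le⟩ z hz
  -- With dilation factor `0` the same estimate bounds `f' - f'(0)` on the whole disk, which
  -- controls the extra term `(1 - r) f'(r z)`.
  have h2 := key 0 (by simp) _ (mul_mem_disk ⟨hr'.1.le, hr'.2.le⟩ hz)
  simp only [Complex.ofReal_zero, zero_mul, sub_zero, Real.one_rpow, mul_one] at h2
  rw [Real.rpow_one] at hr2
  have h3 := norm_le_norm_add_norm_sub' (deriv f (r * z)) (deriv f 0)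
  have h4 := norm_deriv_zero_le f
  have h5 : ‖deriv f (r * z)‖ ≤ ‖f‖ * (1 + 1 / (1 - α)) := by
    rw [mul_add, mul_one, mul_one_div]; linarith
  have h6 : deriv f z - r * deriv f (r * z) =
      (deriv f z - deriv f (r * z)) + ((1 - r : ℝ) : ℂ) * deriv f (r * z) := by
    push_cast; ring
  have h7 : ‖((1 - r : ℝ) : ℂ) * deriv f (r * z)‖ ≤ (1 - r) * (‖f‖ * (1 + 1 / (1 - α))) := by
    rw [norm_mul, Complex.norm_real, Real.norm_eq_abs, abs_of_pos (by linarith [hr'.2])]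
    exact mul_le_mul_of_nonneg_left h5 (by linarith [hr'.2])
  have h8 := mul_le_mul_of_nonneg_left hr (norm_nonneg f)
  have h9 := mul_le_mul_of_nonneg_left hr2 (norm_nonneg f)
  have h10 : ‖f‖ / (1 - α) * (1 - r) ^ (1 - α) = ‖f‖ * (1 / (1 - α) * (1 - r) ^ (1 - α)) := by
    ring
  rw [h6]
  refine (norm_add_le _ _).trans ?_
  linarith

/-- When `G` is unbounded, the triangle inequality is enough: the value at `r z` obeys the bound at
`z` by monotonicity, whence the factor `2`. The scalar `c` is `1` for the function and `r` for its
derivative. -/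
theorem norm_sub_apply_dilation_le {F : ℂ → ℂ} {G : ℝ → ℝ} {A : ℝ}
    (hmono : MonotoneOn G (Set.Ico 0 1)) (hF : ∀ z ∈ 𝔻, ‖F z‖ ≤ A * G ‖z‖) (hA : 0 ≤ A) {r : ℝ}
    (hr : r ∈ Set.Ioo (0 : ℝ) 1) {c : ℂ} (hc : ‖c‖ ≤ 1) {z : ℂ} (hz : z ∈ 𝔻) :
    ‖F z - c * F (r * z)‖ ≤ A * (2 * G ‖z‖) := by
  have h1 := norm_lt_one_of_mem_disk hz
  have h2 := hF z hz
  have h3 := hF _ (mul_mem_disk ⟨hr.1.le, hr.2.le⟩ hz)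
  have h4 : ‖(r : ℂ) * z‖ ≤ ‖z‖ := by
    rw [norm_mul, Complex.norm_real, Real.norm_eq_abs, abs_of_pos hr.1]
    exact mul_le_of_le_one_left (norm_nonneg z) hr.2.le
  have h5 := hmono ⟨norm_nonneg _, h4.trans_lt h1⟩ ⟨norm_nonneg z, h1⟩ h4
  have h6 : ‖c * F (r * z)‖ ≤ ‖F (r * z)‖ := by
    rw [norm_mul]
    exact mul_le_of_le_one_left (norm_nonneg _) hc
  have h7 := mul_le_mul_of_nonneg_left h5 hA
  linarith [norm_sub_le (F z) (c * F (r * z))]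

theorem norm_ofReal_le_one {r : ℝ} (hr : r ∈ Set.Ioo (0 : ℝ) 1) : ‖(r : ℂ)‖ ≤ 1 := by
  rw [Complex.norm_real, Real.norm_eq_abs, abs_of_pos hr.1]
  exact hr.2.le

theorem monotoneOn_const_mul_rpow_neg {K s : ℝ} (hK : 0 ≤ K) (hs : 0 ≤ s) :
    MonotoneOn (fun x : ℝ => K * (1 - x) ^ (-s)) (Set.Ico 0 1) := fun x _ y hy hxy =>
  mul_le_mul_of_nonneg_left (Real.rpow_le_rpow_of_nonpos (by linarith [hy.2]) (by linarith)
    (by linarith)) hK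

theorem monotoneOn_one_add_log {K : ℝ} (hK : 0 ≤ K) :
    MonotoneOn (fun x : ℝ => 1 + K * Real.log (1 - x)⁻¹) (Set.Ico 0 1) := fun x hx y hy hxy => by
  have h1 : 0 < 1 - x := by linarith [hx.2]
  have h2 : 0 < 1 - y := by linarith [hy.2]
  have : Real.log (1 - x)⁻¹ ≤ Real.log (1 - y)⁻¹ :=
    Real.log_le_log (by positivity) ((inv_le_inv₀ h1 h2).2 (by linarith))
  exact add_le_add_right (mul_le_mul_of_nonneg_left this hK) 1

theorem dilationBound_of_lt_one (hα : 0 ≤ α) (hα1 : α < 1) :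
    DilationBound α (fun _ => 0) (fun _ => 0) := by
  intro η hη
  filter_upwards [eventually_norm_sub_le hα (by linarith) hη,
    eventually_norm_deriv_sub_le hα hα1 hη] with r h1 h2 f z hz
  simpa using ⟨h1 f z hz, h2 f z hz⟩

theorem dilationBound_one :
    DilationBound 1 (fun _ => 0) (fun x => 2 * (1 + 1 * Real.log (1 - x)⁻¹)) := by
  intro η hη
  filter_upwards [eventually_norm_sub_le zero_le_one (by norm_num) hη, eventually_mem_Ioo]
    with r h1 hr f z hz
  refine ⟨by simpa using h1 f z hz, ?_⟩
  have := norm_sub_apply_dilation_le (monotoneOn_one_add_log zero_le_one)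
    (fun w hw => by simpa using norm_deriv_le_log f hw) (norm_nonneg f) hr
    (norm_ofReal_le_one hr) hz
  exact this.trans (mul_le_mul_of_nonneg_left (le_add_of_nonneg_left hη.le) (norm_nonneg f))

theorem dilationBound_of_lt_two (hα : 1 < α) (hα2 : α < 2) : DilationBound α (fun _ => 0)
    (fun x => 2 * ((1 + 1 / (α - 1)) * (1 - x) ^ (-(α - 1)))) := by
  intro η hη
  have hK : 0 ≤ 1 + 1 / (α - 1) := by
    have : 0 < α - 1 := by linarith
    positivity
  filter_upwards [eventually_norm_sub_le (by linarith) hα2 hη, eventually_mem_Ioo]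
    with r h1 hr f z hz
  refine ⟨by simpa using h1 f z hz, ?_⟩
  have := norm_sub_apply_dilation_le (monotoneOn_const_mul_rpow_neg hK
    (show 0 ≤ α - 1 by linarith)) (fun w hw => by
      have := norm_deriv_le_rpow (by linarith) (show 0 < α - 1 by linarith) (by linarith) f hw
      exact this.trans (le_of_eq (by ring))) (norm_nonneg f) hr (norm_ofReal_le_one hr) hz
  exact this.trans (mul_le_mul_of_nonneg_left (le_add_of_nonneg_left hη.le) (norm_nonneg f))

theorem dilationBound_two : DilationBound 2 (fun x => 2 * (1 + 2 * Real.log (1 - x)⁻¹))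
    (fun x => 2 * (2 * (1 - x) ^ (-1 : ℝ))) := by
  intro η hη
  filter_upwards [eventually_mem_Ioo] with r hr f z hz
  have h0 := norm_sub_apply_dilation_le (monotoneOn_one_add_log zero_le_two)
    (fun w hw => norm_apply_le_log f hw) (norm_nonneg f) hr (c := 1) (by simp) hz
  have h1 := norm_sub_apply_dilation_le (monotoneOn_const_mul_rpow_neg zero_le_two
    zero_le_one) (fun w hw => by
      have := norm_deriv_le_rpow zero_le_two one_pos (by norm_num) f hw
      exact this.trans (le_of_eq (by ring))) (norm_nonneg f) hr (norm_ofReal_le_one hr) hz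
  rw [one_mul] at h0
  exact ⟨h0.trans (mul_le_mul_of_nonneg_left (le_add_of_nonneg_left hη.le) (norm_nonneg f)),
    h1.trans (mul_le_mul_of_nonneg_left (le_add_of_nonneg_left hη.le) (norm_nonneg f))⟩

theorem dilationBound_of_two_lt (hα : 2 < α) : DilationBound α
    (fun x => 2 * ((1 + (1 + 1 / (α - 1)) / (α - 2)) * (1 - x) ^ (-(α - 2))))
    (fun x => 2 * ((1 + 1 / (α - 1)) * (1 - x) ^ (-(α - 1)))) := by
  intro η hη
  have h1 : 0 < α - 1 := by linarith
  have h2 : 0 < α - 2 := by linarith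
  filter_upwards [eventually_mem_Ioo] with r hr f z hz
  have h3 := norm_sub_apply_dilation_le (monotoneOn_const_mul_rpow_neg
    (K := 1 + (1 + 1 / (α - 1)) / (α - 2)) (by positivity) h2.le) (fun w hw => by
      have := norm_apply_le_rpow hα f hw
      exact this.trans (le_of_eq (by ring))) (norm_nonneg f) hr (c := 1) (by simp) hz
  have h4 := norm_sub_apply_dilation_le (monotoneOn_const_mul_rpow_neg
    (K := 1 + 1 / (α - 1)) (by positivity) h1.le) (fun w hw => by
      have := norm_deriv_le_rpow (by linarith) h1 (by linarith) f hw
      exact this.trans (le_of_eq (by ring))) (norm_nonneg f) hr (norm_ofReal_le_one hr) hz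
  rw [one_mul] at h3
  exact ⟨h3.trans (mul_le_mul_of_nonneg_left (le_add_of_nonneg_left hη.le) (norm_nonneg f)),
    h4.trans (mul_le_mul_of_nonneg_left (le_add_of_nonneg_left hη.le) (norm_nonneg f))⟩

end ZygmundSpace

/-! ### Compact perturbations and the essential norm -/

section Upper

open ZygmundSpace Polynomial

variable {α β : ℝ} {φ g : ℂ → ℂ}

theorem weight_mul_norm_symbol_le (hα : 0 ≤ α) (hφ : DifferentiableOn ℂ φ 𝔻)
    (hm : Set.MapsTo φ 𝔻 𝔻) (hg : DifferentiableOn ℂ g 𝔻)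
    (T : ZygmundSpace α →L[ℂ] ZygmundSpace β)
    (hT : ∀ (f : ZygmundSpace α), ∀ z ∈ 𝔻, T f z = compVolterraU φ g f z) (p : ℂ[X]) {z : ℂ}
    (hz : z ∈ 𝔻) :
    stdWeight β z * ‖symbolU φ g z * p.derivative.eval (φ z) + symbolW φ g z * p.eval (φ z)‖ ≤
      ‖T (ofPoly hα p)‖ := by
  have := weight_mul_norm_deriv2_le (T (ofPoly hα p)) hz
  rwa [deriv2_compVolterraU hφ hm hg (ofPoly hα p).differentiableOn (hT _) hz,
    deriv_ofPoly hα p (hm hz), ofPoly_apply hα p (hm hz)] at this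

/-- Testing on `1` yields `w`, testing on `X` yields `u + w φ`, and `|φ| < 1` separates the two. -/
theorem exists_symbol_bound (hα : 0 ≤ α) (hφ : DifferentiableOn ℂ φ 𝔻) (hm : Set.MapsTo φ 𝔻 𝔻)
    (hg : DifferentiableOn ℂ g 𝔻) (T : ZygmundSpace α →L[ℂ] ZygmundSpace β)
    (hT : ∀ (f : ZygmundSpace α), ∀ z ∈ 𝔻, T f z = compVolterraU φ g f z) :
    ∃ C, 0 ≤ C ∧ ∀ z ∈ 𝔻, stdWeight β z * ‖symbolU φ g z‖ ≤ C ∧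
      stdWeight β z * ‖symbolW φ g z‖ ≤ C := by
  refine ⟨‖T (ofPoly hα X)‖ + ‖T (ofPoly hα 1)‖, by positivity, fun z hz => ?_⟩
  have h1 := weight_mul_norm_symbol_le hα hφ hm hg T hT 1 hz
  have h2 := weight_mul_norm_symbol_le hα hφ hm hg T hT X hz
  simp only [derivative_one, derivative_X, eval_one, eval_zero, eval_X, mul_zero, zero_add,
    mul_one] at h1 h2
  have hv := weight_pos β hz
  have h3 : ‖symbolU φ g z‖ ≤ ‖symbolU φ g z + symbolW φ g z * φ z‖ + ‖symbolW φ g z‖ := by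
    have h4 := norm_sub_le (symbolU φ g z + symbolW φ g z * φ z) (symbolW φ g z * φ z)
    rw [add_sub_cancel_right, norm_mul] at h4
    nlinarith [norm_nonneg (symbolW φ g z), norm_lt_one_of_mem_disk (hm hz)]
  have h5 := mul_le_mul_of_nonneg_left h3 hv.le
  exact ⟨by linarith, by linarith [norm_nonneg (T (ofPoly hα X))]⟩

/-- Compact perturbations of the operator have norm controlled by the weighted symbols near the
boundary. -/
theorem exists_compact_norm_add_le (hα : 0 ≤ α) (hφ : DifferentiableOn ℂ φ 𝔻)
    (hm : Set.MapsTo φ 𝔻 𝔻) (hg : DifferentiableOn ℂ g 𝔻)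
    (T : ZygmundSpace α →L[ℂ] ZygmundSpace β)
    (hT : ∀ (f : ZygmundSpace α), ∀ z ∈ 𝔻, T f z = compVolterraU φ g f z)
    {G₀ G₁ : ℝ → ℝ} (hG : DilationBound α G₀ G₁) {ρ M₀ M₁ : ℝ} (hρ : ρ < 1)
    (hM₀ : 0 ≤ M₀) (hM₁ : 0 ≤ M₁)
    (hw : ∀ z ∈ 𝔻, ρ < ‖φ z‖ → stdWeight β z * ‖symbolW φ g z‖ * G₀ ‖φ z‖ ≤ M₀)
    (hu : ∀ z ∈ 𝔻, ρ < ‖φ z‖ → stdWeight β z * ‖symbolU φ g z‖ * G₁ ‖φ z‖ ≤ M₁)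
    {ε : ℝ} (hε : 0 < ε) :
    ∃ K : ZygmundSpace α →L[ℂ] ZygmundSpace β, IsCompactOperator K ∧
      ‖T + K‖ ≤ M₀ + M₁ + ε := by
  have h0 : (0 : ℂ) ∈ 𝔻 := by simp
  have hφ0 := norm_lt_one_of_mem_disk (hm h0)
  obtain ⟨C, hC0, hC⟩ := exists_symbol_bound hα hφ hm hg T hT
  obtain ⟨D, hD⟩ := (isCompact_closedBall (0 : ℂ) ‖φ 0‖).exists_bound_of_continuousOn
    (f := deriv g) ((hg.deriv Metric.isOpen_ball).continuousOn.mono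
      (Metric.closedBall_subset_ball hφ0))
  have hD' : ∀ z, ‖z‖ ≤ ‖φ 0‖ → ‖deriv g z‖ ≤ D := fun z hz => hD z (by simpa using hz)
  have hD0 : 0 ≤ D := (norm_nonneg _).trans (hD' (φ 0) le_rfl)
  set S := D * ‖φ 0‖ + D * ‖deriv φ 0‖ + 2 * C with hS
  have hS0 : 0 ≤ S := by positivity
  -- `S` collects the factors multiplying `η` in the value at `0`, the derivative at `0` and the
  -- weighted second derivative.
  set η := ε / (S + 1) with hη
  have hη0 : 0 < η := by positivity
  have hηS : η * S ≤ ε := by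
    rw [hη, div_mul_eq_mul_div, div_le_iff₀ (by linarith)]
    nlinarith
  -- The disk on which `f - L f` is small must also contain the segment from `0` to `φ 0`, because
  -- the norm of `T (f - L f)` involves the value and derivative at `0`.
  obtain ⟨L, hL, hLf⟩ := hG.exists_compact hα (max_lt hρ hφ0) hη0
  refine ⟨-(T.comp L), (hL.clm_comp T).neg, ContinuousLinearMap.opNorm_le_bound _
    (by positivity) fun f => ?_⟩
  set h := f - L f with hh
  have hTh : (T + -(T.comp L)) f = T h := by
    simp [hh, sub_eq_add_neg]
  rw [hTh]
  have hsmall : ∀ z, ‖z‖ ≤ ‖φ 0‖ → ‖h z‖ ≤ ‖f‖ * η := fun z hz =>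
    ((hLf f z (by simpa using hz.trans_lt hφ0)).2 (hz.trans (le_max_right _ _))).1
  have hb0 : ‖T h 0‖ ≤ ‖f‖ * η * D * ‖φ 0‖ := by
    rw [hT h 0 h0]
    exact norm_volterraU_le hsmall hD'
  have hb1 : ‖deriv (T h) 0‖ ≤ ‖f‖ * η * D * ‖deriv φ 0‖ := by
    rw [deriv_compVolterraU hφ hm hg h.differentiableOn (hT h) h0, norm_mul, norm_mul]
    gcongr
    exacts [hsmall _ le_rfl, hD' _ le_rfl]
  have hb2 : ∀ z ∈ 𝔻, stdWeight β z * ‖deriv (deriv (T h)) z‖ ≤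
      ‖f‖ * (M₀ + M₁ + 2 * C * η) := by
    intro z hz
    have hv := weight_pos β hz
    obtain ⟨hCu, hCw⟩ := hC z hz
    rw [deriv2_compVolterraU hφ hm hg h.differentiableOn (hT h) hz]
    have hf := norm_nonneg f
    have h1 : stdWeight β z *
        ‖symbolU φ g z * deriv h (φ z) + symbolW φ g z * h (φ z)‖ ≤
        (stdWeight β z * ‖symbolU φ g z‖) * ‖deriv h (φ z)‖ +
          (stdWeight β z * ‖symbolW φ g z‖) * ‖h (φ z)‖ := by
      have := norm_add_le (symbolU φ g z * deriv h (φ z)) (symbolW φ g z * h (φ z))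
      rw [norm_mul, norm_mul] at this
      nlinarith
    have hu0 : 0 ≤ stdWeight β z * ‖symbolU φ g z‖ := by positivity
    have hw0 : 0 ≤ stdWeight β z * ‖symbolW φ g z‖ := by positivity
    obtain ⟨⟨h2, h3⟩, h4⟩ := hLf f (φ z) (hm hz)
    refine h1.trans ?_
    -- Near the boundary the hypotheses on the symbols apply; elsewhere `f - L f` and its derivative
    -- are at most `‖f‖ η`.
    by_cases hρz : ρ < ‖φ z‖
    · have h5 := hu z hz hρz
      have h6 := hw z hz hρz
      have h7 := mul_le_mul_of_nonneg_left h3 hu0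
      have h8 := mul_le_mul_of_nonneg_left h2 hw0
      have h9 := mul_le_mul_of_nonneg_left h5 hf
      have h10 := mul_le_mul_of_nonneg_left h6 hf
      have h11 := mul_le_mul_of_nonneg_left hCu (mul_nonneg hf hη0.le)
      have h12 := mul_le_mul_of_nonneg_left hCw (mul_nonneg hf hη0.le)
      linarith
    · obtain ⟨h5, h6⟩ := h4 ((not_lt.1 hρz).trans (le_max_left _ _))
      have h7 := mul_le_mul hCu h6 (norm_nonneg _) hC0
      have h8 := mul_le_mul hCw h5 (norm_nonneg _) hC0
      have h9 := mul_nonneg hf (add_nonneg hM₀ hM₁)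
      linarith
  refine (norm_le_of_forall (T h) hb0 hb1 hb2).trans ?_
  have := mul_le_mul_of_nonneg_left hηS (norm_nonneg f)
  rw [hS] at this
  linarith

variable {X Y : Type*} [NormedAddCommGroup X] [NormedSpace ℂ X]
    [NormedAddCommGroup Y] [NormedSpace ℂ Y]

theorem essNorm_bddBelow (T : X →L[ℂ] Y) :
    BddBelow {r | ∃ K : X →L[ℂ] Y, IsCompactOperator K ∧ r = ‖T + K‖} :=
  ⟨0, by rintro _ ⟨K, -, rfl⟩; exact norm_nonneg _⟩

theorem essNorm_le (T : X →L[ℂ] Y) {K : X →L[ℂ] Y} (hK : IsCompactOperator K) :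
    essNorm T ≤ ‖T + K‖ :=
  csInf_le (essNorm_bddBelow T) ⟨K, hK, rfl⟩

theorem essNorm_nonneg (T : X →L[ℂ] Y) : 0 ≤ essNorm T :=
  Real.sInf_nonneg (by rintro _ ⟨K, -, rfl⟩; exact norm_nonneg _)

theorem exists_compact_lt_of_essNorm_lt (T : X →L[ℂ] Y) {M : ℝ} (h : essNorm T < M) :
    ∃ K : X →L[ℂ] Y, IsCompactOperator K ∧ ‖T + K‖ < M := by
  have hne : {r | ∃ K : X →L[ℂ] Y, IsCompactOperator K ∧ r = ‖T + K‖}.Nonempty :=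
    ⟨‖T + 0‖, 0, isCompactOperator_zero, rfl⟩
  obtain ⟨_, ⟨K, hK, rfl⟩, hlt⟩ := exists_lt_of_csInf_lt hne h
  exact ⟨K, hK, hlt⟩

end Upper

/-! ### Extended-valued limits superior and real estimates -/

section Limsup

variable {β : ℝ} {c : ℕ → ℝ} {s φ : ℂ → ℂ}

theorem eventually_of_limsupPow_lt {M : ℝ} (hM : 0 ≤ M)
    (h : limsupPow β c s φ < ENNReal.ofReal M) :
    ∀ᶠ n in Filter.atTop, ∀ z ∈ 𝔻, c n * (stdWeight β z * ‖s z * φ z ^ n‖) ≤ M := by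
  filter_upwards [Filter.eventually_lt_of_limsup_lt h] with n hn z hz
  have h0 : 0 ≤ stdWeight β z * ‖s z * φ z ^ n‖ :=
    mul_nonneg (ZygmundSpace.weight_pos β hz).le (norm_nonneg _)
  have h1 : ENNReal.ofReal (stdWeight β z * ‖s z * φ z ^ n‖) ≤
      weightedNorm (stdWeight β) (fun z => s z * φ z ^ n) :=
    le_iSup₂_of_le (f := fun z (_ : z ∈ 𝔻) =>
      ENNReal.ofReal (stdWeight β z * ‖s z * φ z ^ n‖)) z hz le_rfl
  rw [← ENNReal.ofReal_le_ofReal_iff hM, ENNReal.ofReal_mul' h0]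
  exact (mul_le_mul_right h1 _).trans hn.le

theorem limsupPow_le_of_eventually {M : ℝ}
    (h : ∀ᶠ n in Filter.atTop, ∀ z ∈ 𝔻, c n * (stdWeight β z * ‖s z * φ z ^ n‖) ≤ M) :
    limsupPow β c s φ ≤ ENNReal.ofReal M := by
  refine Filter.limsup_le_of_le (by isBoundedDefault) ?_
  filter_upwards [h] with n hn
  simp only [weightedNorm, ENNReal.mul_iSup]
  refine iSup₂_le fun z hz => ?_
  have h0 : 0 ≤ stdWeight β z * ‖s z * φ z ^ n‖ :=
    mul_nonneg (ZygmundSpace.weight_pos β hz).le (norm_nonneg _)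
  rw [← ENNReal.ofReal_mul' h0]
  exact ENNReal.ofReal_le_ofReal (hn z hz)

/-- It suffices to test against real numbers above `L`; if `L = ∞` there are none and the conclusion
is trivial. -/
theorem ofReal_inv_mul_le_of_forall {L : ℝ≥0∞} {C e : ℝ} (hC : 0 < C)
    (h : ∀ M : ℝ, 0 ≤ M → L < ENNReal.ofReal M → e ≤ C * M) :
    ENNReal.ofReal C⁻¹ * ENNReal.ofReal e ≤ L := by
  rw [← ENNReal.ofReal_mul (inv_nonneg.2 hC.le)]
  refine le_of_forall_gt_imp_ge_of_dense fun x hx => ?_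
  rcases eq_or_ne x ⊤ with rfl | hx'
  · exact le_top
  · rw [← ENNReal.ofReal_toReal hx'] at hx ⊢
    have := h _ ENNReal.toReal_nonneg hx
    refine ENNReal.ofReal_le_ofReal ?_
    rwa [inv_mul_le_iff₀ hC]

/-- The slack `ε` arises because the infimum in the essential norm need not be attained; it is
removed by `ε → 0`. A finite right-hand side also shows that the limit superior is finite. -/
theorem limsupPow_le_mul {C e : ℝ} (hC : 0 < C) (h : ∀ ε > 0, ∀ᶠ n in Filter.atTop, ∀ z ∈ 𝔻,
      c n * (stdWeight β z * ‖s z * φ z ^ n‖) ≤ C * (e + ε)) :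
    limsupPow β c s φ ≤ ENNReal.ofReal C * ENNReal.ofReal e := by
  rw [← ENNReal.ofReal_mul hC.le]
  have h1 : Filter.Tendsto (fun ε : ℝ => ENNReal.ofReal (C * (e + ε)))
      (nhdsWithin 0 (Set.Ioi 0)) (nhds (ENNReal.ofReal (C * e))) := by
    have hc : Continuous fun ε : ℝ => ENNReal.ofReal (C * (e + ε)) :=
      ENNReal.continuous_ofReal.comp (by fun_prop)
    have := hc.tendsto 0
    rw [add_zero] at this
    exact this.mono_left nhdsWithin_le_nhds
  refine ge_of_tendsto h1 ?_
  filter_upwards [self_mem_nhdsWithin] with ε hε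
  exact limsupPow_le_of_eventually (h ε hε)

end Limsup

/-! ### Domination of growth functions by monomials -/

/-- Near the boundary, the growth function `G` is dominated by the monomials `c(k) xᵏ` of
arbitrarily large degree. -/
def DominatedBy (G : ℝ → ℝ) (c : ℕ → ℝ) : Prop :=
  ∃ C, 0 < C ∧ ∀ m : ℕ, ∃ ρ < 1, ∀ x, ρ < x → x < 1 → ∃ k ≥ m, G x ≤ C * (c k * x ^ k)

/-- Bernoulli's inequality: `xᵏ ≥ 1 - k(1 - x) ≥ 1/2` as soon as `k ≤ 1 / (2(1 - x))`. -/
theorem exists_half_le_pow {x : ℝ} (hx0 : 0 ≤ x) (hx : x < 1) :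
    ∃ k : ℕ, k = ⌊(1 - x)⁻¹ / 2⌋₊ ∧ (1 - x)⁻¹ ≤ 2 * (k + 1) ∧ 1 / 2 ≤ x ^ k := by
  have ht : 0 < 1 - x := by linarith
  refine ⟨_, rfl, ?_, ?_⟩
  · linarith [Nat.lt_floor_add_one ((1 - x)⁻¹ / 2)]
  · have h1 := Nat.floor_le (a := (1 - x)⁻¹ / 2) (by positivity)
    set k := ⌊(1 - x)⁻¹ / 2⌋₊
    have h2 := one_add_mul_le_pow (a := x - 1) (by linarith) k
    have h3 : (k : ℝ) * (1 - x) ≤ 1 / 2 := by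
      have := mul_le_mul_of_nonneg_right h1 ht.le
      rwa [div_mul_eq_mul_div, inv_mul_cancel₀ ht.ne'] at this
    rw [add_sub_cancel] at h2
    linarith

theorem exists_le_pow (m : ℕ) : ∃ ρ : ℝ, ρ < 1 ∧ ∀ x, ρ < x → x < 1 →
    ∃ k ≥ m, (1 - x)⁻¹ ≤ 2 * (k + 1) ∧ 1 / 2 ≤ x ^ k := by
  -- Beyond this radius `(1 - x)⁻¹ / 2 > m + 1`, so its floor is at least `m`.
  refine ⟨1 - 1 / (2 * (m + 1)), by simp; positivity, fun x hρ hx => ?_⟩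
  have h1 : (1 : ℝ) / (2 * (m + 1)) ≤ 1 := by
    rw [div_le_one (by positivity)]
    linarith [(Nat.cast_nonneg m : (0 : ℝ) ≤ m)]
  obtain ⟨k, hk, h2, h3⟩ := exists_half_le_pow (by linarith : 0 ≤ x) hx
  refine ⟨k, ?_, h2, h3⟩
  rw [hk]
  refine Nat.le_floor ?_
  have ht : 0 < 1 - x := by linarith
  have h4 : 1 - x < 1 / (2 * (m + 1)) := by linarith
  rw [lt_div_iff₀ (by positivity)] at h4
  rw [le_div_iff₀ two_pos, ← one_div, le_div_iff₀ ht]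
  nlinarith

/-- A version of the domination valid on the whole interval. -/
theorem exists_pow_mul_inv_le {x : ℝ} (hx0 : 0 ≤ x) (hx : x < 1) (m : ℕ) :
    ∃ k ≥ m, x ^ m * (1 - x)⁻¹ ≤ 4 * ((k + 1) * x ^ k) := by
  obtain ⟨k, hk, h2, h3⟩ := exists_half_le_pow hx0 hx
  have ht : 0 < 1 - x := by linarith
  by_cases hkm : m ≤ k
  · refine ⟨k, hkm, ?_⟩
    have h4 := mul_le_mul_of_nonneg_left h3 (show (0 : ℝ) ≤ 4 * (k + 1) by positivity)
    have h5 : x ^ m ≤ 1 := pow_le_one₀ hx0 hx.le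
    have h6 : 0 < (1 - x)⁻¹ := by positivity
    nlinarith
  -- If the natural degree is below `m`, then `(1 - x)⁻¹ ≤ 2(k + 1) ≤ 2m`, and the degree `m` itself
  -- works.
  · refine ⟨m, le_rfl, ?_⟩
    have h4 : (k : ℝ) + 1 ≤ m := by exact_mod_cast not_le.1 hkm
    have h5 : (1 - x)⁻¹ ≤ 4 * (m + 1) := by linarith [(Nat.cast_nonneg k : (0 : ℝ) ≤ k)]
    have h6 := mul_le_mul_of_nonneg_left h5 (pow_nonneg hx0 m)
    linarith

theorem dominatedBy_rpow {K s : ℝ} (hK : 0 < K) (hs : 0 ≤ s) :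
    DominatedBy (fun x => 2 * (K * (1 - x) ^ (-s))) (fun n => ((n : ℝ) + 1) ^ s) := by
  refine ⟨4 * K * 2 ^ s, by positivity, fun m => ?_⟩
  obtain ⟨ρ, hρ, h⟩ := exists_le_pow m
  refine ⟨ρ, hρ, fun x hx hx1 => ?_⟩
  obtain ⟨k, hk, h1, h2⟩ := h x hx hx1
  refine ⟨k, hk, ?_⟩
  have ht : 0 < 1 - x := by linarith
  have h3 : (1 - x) ^ (-s) ≤ 2 ^ s * ((k : ℝ) + 1) ^ s := by
    rw [Real.rpow_neg ht.le, ← Real.inv_rpow ht.le,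
      ← Real.mul_rpow zero_le_two (by positivity)]
    exact Real.rpow_le_rpow (by positivity) h1 hs
  have h4 : (0 : ℝ) ≤ 4 * K * (2 ^ s * ((k : ℝ) + 1) ^ s) := by positivity
  have h5 := mul_le_mul_of_nonneg_left h2 h4
  have h6 := mul_le_mul_of_nonneg_left h3 hK.le
  linarith

theorem dominatedBy_log {K : ℝ} (hK : 0 ≤ K) :
    DominatedBy (fun x => 2 * (1 + K * Real.log (1 - x)⁻¹)) (fun n => Real.log n) := by
  refine ⟨4 * (1 + 3 * K), by positivity, fun m => ?_⟩
  obtain ⟨ρ, hρ, h⟩ := exists_le_pow (max m 3)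
  refine ⟨ρ, hρ, fun x hx hx1 => ?_⟩
  obtain ⟨k, hk, h1, h2⟩ := h x hx hx1
  refine ⟨k, (le_max_left _ _).trans hk, ?_⟩
  have hk3 : (3 : ℝ) ≤ k := by exact_mod_cast (le_max_right _ _).trans hk
  have ht : 0 < 1 - x := by linarith
  have h3 : Real.log (1 - x)⁻¹ ≤ 3 * Real.log k := by
    have : Real.log ((k : ℝ) ^ 3) = 3 * Real.log k := by
      rw [Real.log_pow]; norm_num
    rw [← this]
    exact Real.log_le_log (by positivity) (h1.trans (by nlinarith [sq_nonneg ((k : ℝ) - 3)]))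
  have h4 : 1 ≤ Real.log k := by
    rw [Real.le_log_iff_exp_le (by linarith)]
    linarith [Real.exp_one_lt_d9]
  have h5 := mul_le_mul_of_nonneg_left h2 (show 0 ≤ 4 * (1 + 3 * K) * Real.log k by positivity)
  have h6 := mul_le_mul_of_nonneg_left h3 hK
  nlinarith

/-- The degree `k` depends on `|φ(z)|`, so the monomial bound is needed for all large degrees at
once. The constant depends only on `G` and `c`, whereas `ρ` may depend on the symbols. -/
theorem DominatedBy.exists_symbol_le {G : ℝ → ℝ} {c : ℕ → ℝ} (h : DominatedBy G c) :
    ∃ C, 0 < C ∧ ∀ (β : ℝ) (s φ : ℂ → ℂ) (M : ℝ), Set.MapsTo φ 𝔻 𝔻 →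
      (∀ᶠ n in Filter.atTop, ∀ z ∈ 𝔻, c n * (stdWeight β z * ‖s z * φ z ^ n‖) ≤ M) →
      ∃ ρ < 1, ∀ z ∈ 𝔻, ρ < ‖φ z‖ → stdWeight β z * ‖s z‖ * G ‖φ z‖ ≤ C * M := by
  obtain ⟨C, hC, h⟩ := h
  refine ⟨C, hC, fun β s φ M hm hM => ?_⟩
  obtain ⟨m, hmM⟩ := Filter.eventually_atTop.1 hM
  obtain ⟨ρ, hρ, h⟩ := h m
  refine ⟨ρ, hρ, fun z hz hzρ => ?_⟩
  obtain ⟨k, hk, h1⟩ := h _ hzρ (norm_lt_one_of_mem_disk (hm hz))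
  have h2 := mul_le_mul_of_nonneg_left h1
    (mul_nonneg (ZygmundSpace.weight_pos β hz).le (norm_nonneg (s z)))
  have h3 := mul_le_mul_of_nonneg_left (hmM k hk z hz) hC.le
  rw [norm_mul, norm_pow] at h3
  refine h2.trans (le_trans (le_of_eq ?_) h3)
  ring

/-! ### Upper bounds for the essential norm -/

section Upper

open ZygmundSpace

variable {α β : ℝ} {G₀ G₁ : ℝ → ℝ} {c₀ c₁ : ℕ → ℝ}

theorem exists_ofReal_mul_essNorm_le_max (hα : 0 ≤ α) (hG : DilationBound α G₀ G₁)
    (h₀ : DominatedBy G₀ c₀) (h₁ : DominatedBy G₁ c₁) :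
    ∃ C, 0 < C ∧ ∀ (φ g : ℂ → ℂ), DifferentiableOn ℂ φ 𝔻 → Set.MapsTo φ 𝔻 𝔻 →
      DifferentiableOn ℂ g 𝔻 → ∀ T : ZygmundSpace α →L[ℂ] ZygmundSpace β,
      (∀ (f : ZygmundSpace α), ∀ z ∈ 𝔻, T f z = compVolterraU φ g f z) →
      ENNReal.ofReal C * ENNReal.ofReal (essNorm T) ≤
        max (limsupPow β c₁ (symbolU φ g) φ) (limsupPow β c₀ (symbolW φ g) φ) := by
  obtain ⟨C₀, hC₀, h₀⟩ := h₀.exists_symbol_le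
  obtain ⟨C₁, hC₁, h₁⟩ := h₁.exists_symbol_le
  refine ⟨(C₀ + C₁)⁻¹, by positivity, fun φ g hφ hm hg T hT => ?_⟩
  refine ofReal_inv_mul_le_of_forall (by positivity) fun M hM hL => ?_
  rw [max_lt_iff] at hL
  obtain ⟨ρ₀, hρ₀, h₀⟩ := h₀ β (symbolW φ g) φ M hm (eventually_of_limsupPow_lt hM hL.2)
  obtain ⟨ρ₁, hρ₁, h₁⟩ := h₁ β (symbolU φ g) φ M hm (eventually_of_limsupPow_lt hM hL.1)
  refine le_of_forall_pos_le_add fun ε hε => ?_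
  obtain ⟨K, hK, hTK⟩ := exists_compact_norm_add_le hα hφ hm hg T hT hG (max_lt hρ₀ hρ₁)
    (mul_nonneg hC₀.le hM) (mul_nonneg hC₁.le hM)
    (fun z hz h => h₀ z hz ((le_max_left _ _).trans_lt h))
    (fun z hz h => h₁ z hz ((le_max_right _ _).trans_lt h)) hε
  linarith [essNorm_le T hK]

theorem exists_ofReal_mul_essNorm_le (hα : 0 ≤ α) (hG : DilationBound α (fun _ => 0) G₁)
    (h₁ : DominatedBy G₁ c₁) :
    ∃ C, 0 < C ∧ ∀ (φ g : ℂ → ℂ), DifferentiableOn ℂ φ 𝔻 → Set.MapsTo φ 𝔻 𝔻 →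
      DifferentiableOn ℂ g 𝔻 → ∀ T : ZygmundSpace α →L[ℂ] ZygmundSpace β,
      (∀ (f : ZygmundSpace α), ∀ z ∈ 𝔻, T f z = compVolterraU φ g f z) →
      ENNReal.ofReal C * ENNReal.ofReal (essNorm T) ≤ limsupPow β c₁ (symbolU φ g) φ := by
  obtain ⟨C₁, hC₁, h₁⟩ := h₁.exists_symbol_le
  refine ⟨C₁⁻¹, by positivity, fun φ g hφ hm hg T hT => ?_⟩
  refine ofReal_inv_mul_le_of_forall (by positivity) fun M hM hL => ?_
  obtain ⟨ρ₁, hρ₁, h₁⟩ := h₁ β (symbolU φ g) φ M hm (eventually_of_limsupPow_lt hM hL)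
  refine le_of_forall_pos_le_add fun ε hε => ?_
  obtain ⟨K, hK, hTK⟩ := exists_compact_norm_add_le hα hφ hm hg T hT hG hρ₁
    le_rfl (mul_nonneg hC₁.le hM) (fun z _ _ => by simp) h₁ hε
  linarith [essNorm_le T hK]

/-- With both growth functions zero, compact operators come arbitrarily close to `T` in norm, and
they form a closed set. -/
theorem isCompactOperator_of_lt_one (hα : 0 ≤ α) (hα1 : α < 1) (hβ : 0 ≤ β) {φ g : ℂ → ℂ}
    (hφ : DifferentiableOn ℂ φ 𝔻) (hm : Set.MapsTo φ 𝔻 𝔻) (hg : DifferentiableOn ℂ g 𝔻)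
    (T : ZygmundSpace α →L[ℂ] ZygmundSpace β)
    (hT : ∀ (f : ZygmundSpace α), ∀ z ∈ 𝔻, T f z = compVolterraU φ g f z) :
    IsCompactOperator T := by
  have := completeSpace hβ
  have hcl : IsClosed {S : ZygmundSpace α →L[ℂ] ZygmundSpace β | IsCompactOperator S} :=
    isClosed_setOfPred_isCompactOperator
  refine hcl.closure_subset (Metric.mem_closure_iff.2 fun ε hε => ?_)
  obtain ⟨K, hK, hTK⟩ := exists_compact_norm_add_le hα hφ hm hg T hT
    (dilationBound_of_lt_one hα hα1) (ρ := 0) one_pos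
    le_rfl le_rfl (fun z _ _ => by simp) (fun z _ _ => by simp) (half_pos hε)
  refine ⟨-K, hK.neg, ?_⟩
  rw [dist_eq_norm, sub_neg_eq_add]
  linarith

theorem essNorm_eq_zero {X Y : Type*} [NormedAddCommGroup X] [NormedSpace ℂ X]
    [NormedAddCommGroup Y] [NormedSpace ℂ Y] {T : X →L[ℂ] Y} (hT : IsCompactOperator T) :
    essNorm T = 0 := by
  refine le_antisymm ?_ (essNorm_nonneg T)
  have := essNorm_le T (K := -T) hT.neg
  simpa using this

end Upper

/-! ### Compact operators along gliding humps -/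

/-- Gliding hump: a compact operator sends a sequence to zero if adding its far terms to a fixed
element does not increase the norm beyond a fixed bound. -/
theorem IsCompactOperator.eventually_norm_le {X Y : Type*} [NormedAddCommGroup X]
    [NormedSpace ℂ X] [NormedAddCommGroup Y] [NormedSpace ℂ Y] {K : X →L[ℂ] Y}
    (hK : IsCompactOperator K) {P : AddSubmonoid X} {f : ℕ → X} (hf : ∀ n, f n ∈ P) {B : ℝ}
    (hB0 : 0 ≤ B)
    (hB : ∀ p ∈ P, ∀ δ > 0, ∀ᶠ n in Filter.atTop, ‖p + f n‖ ≤ max ‖p‖ B + δ) {ε : ℝ}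
    (hε : 0 < ε) : ∀ᶠ n in Filter.atTop, ‖K (f n)‖ ≤ ε := by
  by_contra hcon
  have h1 : ∃ᶠ n in Filter.atTop, ε < ‖K (f n)‖ := by
    simpa [Filter.Frequently] using hcon
  -- The case `p = 0` bounds the sequence itself, so compactness gives a limit `y` of a subsequence
  -- of images, of norm at least `ε`.
  have h2 := hB 0 P.zero_mem 1 one_pos
  obtain ⟨σ, hσ, h3⟩ := Filter.extraction_of_frequently_atTop (h1.and_eventually h2)
  have hcomp := hK.isCompact_closure_image_of_bounded (f := (K : X →ₗ[ℂ] Y))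
    (Metric.isBounded_closedBall (x := (0 : X)) (r := B + 1))
  obtain ⟨y, -, τ, hτ, hlim⟩ := hcomp.tendsto_subseq (x := fun n => K (f (σ n))) (fun n =>
    subset_closure ⟨f (σ n), by simpa [max_eq_right hB0] using (h3 n).2, rfl⟩)
  obtain ⟨N₀, hN₀⟩ := Metric.tendsto_atTop.1 hlim (ε / 2) (half_pos hε)
  have hy : ε ≤ ‖y‖ := ge_of_tendsto hlim.norm (Filter.Eventually.of_forall fun n => (h3 _).1.le)
  have hστ : Filter.Tendsto (σ ∘ τ) Filter.atTop Filter.atTop :=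
    hσ.tendsto_atTop.comp hτ.tendsto_atTop
  -- `p` is a sum of `N` terms of the sequence, each chosen far out relative to the previous partial
  -- sum. Its norm stays near `B`, while `‖K p‖` is at least `N ε / 2`, contradicting the
  -- boundedness of `K` for large `N`.
  have claim : ∀ N : ℕ, ∀ δ > 0, ∃ p ∈ P, ‖p‖ ≤ B + δ ∧ ‖K p - (N : ℂ) • y‖ ≤ N * (ε / 2) := by
    intro N
    induction N with
    | zero => exact fun δ hδ => ⟨0, P.zero_mem, by simp; linarith, by simp⟩
    | succ N ih =>
      intro δ hδ
      obtain ⟨p, hp, hpB, hpK⟩ := ih (δ / 2) (half_pos hδ)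
      obtain ⟨n, hn, hnN⟩ := ((hστ.eventually (hB p hp (δ / 2) (half_pos hδ))).and
        (Filter.eventually_ge_atTop N₀)).exists
      refine ⟨p + f (σ (τ n)), P.add_mem hp (hf _), ?_, ?_⟩
      · have : max ‖p‖ B ≤ B + δ / 2 := max_le hpB (by linarith)
        simp only [Function.comp_apply] at hn
        linarith
      · have h4 := hN₀ n hnN
        rw [dist_eq_norm] at h4
        have h5 : K (p + f (σ (τ n))) - ((N + 1 : ℕ) : ℂ) • y =
            (K p - (N : ℂ) • y) + (K (f (σ (τ n))) - y) := by
          rw [map_add]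
          push_cast
          rw [add_smul, one_smul]
          abel
        rw [h5]
        refine (norm_add_le _ _).trans ?_
        simp only [Function.comp_apply] at h4
        push_cast
        linarith
  obtain ⟨N, hN⟩ := exists_nat_gt (‖K‖ * (B + 1) / (ε / 2))
  rw [div_lt_iff₀ (half_pos hε)] at hN
  obtain ⟨p, -, hpB, hpK⟩ := claim N 1 one_pos
  have h4 := K.le_opNorm p
  have h5 := mul_le_mul_of_nonneg_left hpB (norm_nonneg K)
  have h6 : ‖(N : ℂ) • y‖ = N * ‖y‖ := by rw [norm_smul, Complex.norm_natCast]
  have h7 := norm_sub_norm_le ((N : ℂ) • y) (K p)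
  rw [norm_sub_rev, h6] at h7
  have h8 := mul_le_mul_of_nonneg_left hy (Nat.cast_nonneg (α := ℝ) N)
  linarith

namespace ZygmundSpace

variable {α β : ℝ}

/-- The functions of the little Zygmund type space that vanish to second order at the origin. -/
def littleSubmonoid (α : ℝ) : AddSubmonoid (ZygmundSpace α) where
  carrier := {f | f 0 = 0 ∧ deriv f 0 = 0 ∧ ∀ δ > 0, ∃ ρ < 1, ∀ z ∈ 𝔻, ρ < ‖z‖ →
    stdWeight α z * ‖deriv (deriv f) z‖ ≤ δ}
  zero_mem' := by
    have h0 : ((0 : ZygmundSpace α) : ℂ → ℂ) = fun _ => 0 := rfl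
    refine ⟨rfl, by simp [h0], fun δ hδ => ⟨0, one_pos, fun z _ _ => ?_⟩⟩
    simp [h0, hδ.le]
  add_mem' := by
    rintro f g ⟨hf0, hf1, hf⟩ ⟨hg0, hg1, hg⟩
    refine ⟨by rw [add_apply, hf0, hg0, add_zero], by
      rw [deriv_add' f g (by simp), hf1, hg1, add_zero], fun δ hδ => ?_⟩
    obtain ⟨ρ, hρ, h1⟩ := hf (δ / 2) (half_pos hδ)
    obtain ⟨ρ', hρ', h2⟩ := hg (δ / 2) (half_pos hδ)
    refine ⟨max ρ ρ', max_lt hρ hρ', fun z hz hzρ => ?_⟩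
    have h3 := h1 z hz ((le_max_left _ _).trans_lt hzρ)
    have h4 := h2 z hz ((le_max_right _ _).trans_lt hzρ)
    have h5 := mul_le_mul_of_nonneg_left
      (norm_add_le (deriv (deriv f) z) (deriv (deriv g) z)) (weight_pos α hz).le
    rw [deriv2_add f g hz]
    linarith

/-- The second derivative is bounded and the weight vanishes at the boundary because `α > 0`. -/
theorem ofPoly_mem_littleSubmonoid (hα : 0 < α) {p : Polynomial ℂ} (h0 : p.eval 0 = 0)
    (h1 : p.derivative.eval 0 = 0) : ofPoly hα.le p ∈ littleSubmonoid α := by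
  have hz : (0 : ℂ) ∈ 𝔻 := by simp
  refine ⟨by rw [ofPoly_apply _ _ hz, h0], by rw [deriv_ofPoly _ _ hz, h1], fun δ hδ => ?_⟩
  obtain ⟨C, hC⟩ := p.derivative.derivative.exists_norm_eval_le
  have hlim : Filter.Tendsto (fun x : ℝ => (1 - x ^ 2) ^ α * C) (nhds 1) (nhds 0) := by
    have hc : Continuous (fun x : ℝ => (1 - x ^ 2) ^ α * C) :=
      ((continuous_const.sub (continuous_pow 2)).rpow_const fun _ => Or.inr hα.le).mul
        continuous_const
    simpa [Real.zero_rpow hα.ne'] using hc.tendsto 1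
  obtain ⟨ρ, hρ, h⟩ := (mem_nhdsLT_iff_exists_Ioo_subset (a := (1 : ℝ))).1
    ((hlim.mono_left nhdsWithin_le_nhds).eventually (gt_mem_nhds hδ))
  refine ⟨ρ, hρ, fun z hz hzρ => ?_⟩
  rw [deriv2_ofPoly _ _ hz]
  exact (mul_le_mul_of_nonneg_left (hC z hz) (weight_pos α hz).le).trans
    (h ⟨hzρ, norm_lt_one_of_mem_disk hz⟩ : (1 - ‖z‖ ^ 2) ^ α * C < δ).le

theorem norm_eq_of_mem_littleSubmonoid {f : ZygmundSpace α} (hf : f ∈ littleSubmonoid α) :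
    ‖f‖ = ⨆ z : 𝔻, stdWeight α z * ‖deriv (deriv f) z‖ := by
  rw [norm_def, hf.1, hf.2.1]
  simp

theorem norm_le_of_mem_littleSubmonoid {f : ZygmundSpace α} (hf : f ∈ littleSubmonoid α) {C : ℝ}
    (hC : ∀ z ∈ 𝔻, stdWeight α z * ‖deriv (deriv f) z‖ ≤ C) : ‖f‖ ≤ C := by
  have : Nonempty 𝔻 := ⟨⟨0, by simp⟩⟩
  rw [norm_eq_of_mem_littleSubmonoid hf]
  exact ciSup_le fun z : 𝔻 => hC z z.2

/-- Near the boundary `p` contributes at most `δ`, and on the remaining disk the far terms `f n` do.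
The humps are thus almost disjoint and the supremum behaves like a maximum instead of a sum. -/
theorem eventually_norm_add_le (hα : 0 ≤ α) {f : ℕ → ZygmundSpace α} {B : ℝ}
    (hf : ∀ n, f n ∈ littleSubmonoid α)
    (hB : ∀ n, ∀ z ∈ 𝔻, stdWeight α z * ‖deriv (deriv (f n)) z‖ ≤ B)
    (hloc : ∀ ρ < 1, ∀ δ > 0, ∀ᶠ n in Filter.atTop, ∀ z, ‖z‖ ≤ ρ →
      ‖deriv (deriv (f n)) z‖ ≤ δ) {p : ZygmundSpace α} (hp : p ∈ littleSubmonoid α) {δ : ℝ}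
    (hδ : 0 < δ) : ∀ᶠ n in Filter.atTop, ‖p + f n‖ ≤ max ‖p‖ B + δ := by
  obtain ⟨ρ, hρ, h1⟩ := hp.2.2 δ hδ
  filter_upwards [hloc ρ hρ δ hδ] with n hn
  refine norm_le_of_mem_littleSubmonoid ((littleSubmonoid α).add_mem hp (hf n)) fun z hz => ?_
  rw [deriv2_add p (f n) hz]
  have hv := weight_pos α hz
  have h2 := mul_le_mul_of_nonneg_left
    (norm_add_le (deriv (deriv p) z) (deriv (deriv (f n)) z)) hv.le
  have h3 := weight_mul_norm_deriv2_le p hz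
  have h4 := hB n z hz
  have h5 := le_max_left ‖p‖ B
  have h6 := le_max_right ‖p‖ B
  by_cases hzρ : ρ < ‖z‖
  · linarith [h1 z hz hzρ]
  · have h7 := hn z (not_lt.1 hzρ)
    have h8 := stdWeight_le_one hα hz
    have h9 := mul_le_mul h8 h7 (norm_nonneg _) zero_le_one
    linarith

/-- The essential norm controls the operator along families of functions in the little space that
are bounded and whose second derivatives tend to zero locally uniformly. -/
theorem eventually_norm_map_le {ι : Type*} [Nonempty ι] (hα : 0 ≤ α)
    {Y : Type*} [NormedAddCommGroup Y] [NormedSpace ℂ Y]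
    (T : ZygmundSpace α →L[ℂ] Y) {f : ℕ → ι → ZygmundSpace α} {B : ℝ}
    (hf : ∀ n i, f n i ∈ littleSubmonoid α)
    (hB : ∀ n i, ∀ z ∈ 𝔻, stdWeight α z * ‖deriv (deriv (f n i)) z‖ ≤ B)
    (hloc : ∀ ρ < 1, ∀ δ > 0, ∀ᶠ n in Filter.atTop, ∀ i z, ‖z‖ ≤ ρ →
      ‖deriv (deriv (f n i)) z‖ ≤ δ) {ε : ℝ} (hε : 0 < ε) :
    ∀ᶠ n in Filter.atTop, ∀ i, ‖T (f n i)‖ ≤ B * (essNorm T + ε) := by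
  -- For each `n` pick an index violating the desired bound if there is one; uniformity in `i` then
  -- follows from the result for a single sequence.
  have hsel : ∀ n, ∃ i, ∀ j, B * (essNorm T + ε) < ‖T (f n j)‖ →
      B * (essNorm T + ε) < ‖T (f n i)‖ := by
    intro n
    by_cases h : ∃ j, B * (essNorm T + ε) < ‖T (f n j)‖
    · exact ⟨h.choose, fun _ _ => h.choose_spec⟩
    · exact ⟨Classical.arbitrary ι, fun j hj => (h ⟨j, hj⟩).elim⟩
  choose i hi using hsel
  have hnorm : ∀ n, ‖f n (i n)‖ ≤ B := fun n =>
    norm_le_of_mem_littleSubmonoid (hf n _) (hB n _)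
  have hB0 : 0 ≤ B := (norm_nonneg _).trans (hnorm 0)
  rcases hB0.eq_or_lt with hB0' | hB0'
  · refine Filter.Eventually.of_forall fun n j => ?_
    have : f n j = 0 := norm_le_zero_iff.1
      ((norm_le_of_mem_littleSubmonoid (hf n j) (hB n j)).trans hB0'.ge)
    simp [this, ← hB0']
  obtain ⟨K, hK, hTK⟩ := exists_compact_lt_of_essNorm_lt T (M := essNorm T + ε / 2) (by linarith)
  have hKf := hK.eventually_norm_le (f := fun n => f n (i n)) (fun n => hf n _) hB0
    (fun p hp δ hδ => eventually_norm_add_le hα (fun n => hf n _) (fun n => hB n _)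
      (fun ρ hρ δ hδ => (hloc ρ hρ δ hδ).mono fun n hn => hn _) hp hδ)
    (show 0 < B * (ε / 2) by positivity)
  filter_upwards [hKf] with n hn j
  by_contra hcon
  have h1 := hi n j (not_le.1 hcon)
  have h2 : T (f n (i n)) = (T + K) (f n (i n)) - K (f n (i n)) := by simp
  have h3 := norm_sub_le ((T + K) (f n (i n))) (K (f n (i n)))
  rw [← h2] at h3
  have h4 := (T + K).le_of_opNorm_le_of_le hTK.le (hnorm n)
  linarith

end ZygmundSpace

/-! ### Lower bounds from monomials -/

section Monomials

open ZygmundSpace Polynomial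

/-- With `y = (1 - x)(n + 2)`, use `xⁿ ≤ exp(-n(1 - x))` and `y^α ≤ α^α exp y`; the exponents add up
to `2(1 - x) ≤ 2`. -/
theorem rpow_mul_pow_le {α : ℝ} (hα : 0 < α) (n : ℕ) {x : ℝ} (hx0 : 0 ≤ x) (hx : x < 1) :
    (1 - x ^ 2) ^ α * (((n : ℝ) + 2) ^ α * x ^ n) ≤ (2 * α) ^ α * Real.exp 2 := by
  have ht : 0 < 1 - x := by linarith
  have h1 : (1 - x ^ 2) ^ α ≤ (2 * (1 - x)) ^ α :=
    Real.rpow_le_rpow (by nlinarith) (by nlinarith) hα.le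
  have h2 : x ^ n ≤ Real.exp (n * (x - 1)) := by
    rw [Real.exp_nat_mul]
    exact pow_le_pow_left₀ hx0 (by linarith [Real.add_one_le_exp (x - 1)]) n
  set y := (1 - x) * ((n : ℝ) + 2) with hy
  have hy0 : 0 ≤ y := by positivity
  have h3 : y ^ α ≤ α ^ α * Real.exp y := by
    have h4 : y / α ≤ Real.exp (y / α) := by linarith [Real.add_one_le_exp (y / α)]
    have h5 := Real.rpow_le_rpow (by positivity) h4 hα.le
    rw [← Real.exp_mul, div_mul_cancel₀ _ hα.ne', Real.div_rpow hy0 hα.le,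
      div_le_iff₀ (Real.rpow_pos_of_pos hα _)] at h5
    linarith
  calc (1 - x ^ 2) ^ α * (((n : ℝ) + 2) ^ α * x ^ n)
      ≤ (2 * (1 - x)) ^ α * (((n : ℝ) + 2) ^ α * Real.exp (n * (x - 1))) := by gcongr
    _ = 2 ^ α * y ^ α * Real.exp (n * (x - 1)) := by
      rw [hy, Real.mul_rpow zero_le_two ht.le, Real.mul_rpow ht.le (by positivity)]
      ring
    _ ≤ 2 ^ α * (α ^ α * Real.exp y) * Real.exp (n * (x - 1)) := by gcongr
    _ = (2 * α) ^ α * Real.exp (y + n * (x - 1)) := by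
      rw [Real.mul_rpow zero_le_two hα.le, Real.exp_add]
      ring
    _ ≤ (2 * α) ^ α * Real.exp 2 := by
      gcongr
      rw [hy]
      linarith

theorem tendsto_rpow_mul_pow {α ρ : ℝ} (hρ0 : 0 ≤ ρ) (hρ : ρ < 1) :
    Filter.Tendsto (fun n : ℕ => ((n : ℝ) + 2) ^ α * ρ ^ n) Filter.atTop (nhds 0) := by
  obtain ⟨k, hk⟩ := exists_nat_ge α
  have h1 : Filter.Tendsto (fun n : ℕ => 3 ^ k * ((n : ℝ) ^ k * ρ ^ n)) Filter.atTop (nhds 0) := by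
    simpa using (tendsto_pow_const_mul_const_pow_of_abs_lt_one k
      (by rwa [abs_of_nonneg hρ0] : |ρ| < 1)).const_mul (3 ^ k)
  refine squeeze_zero' (Filter.Eventually.of_forall fun n => by positivity) ?_ h1
  filter_upwards [Filter.eventually_ge_atTop 1] with n hn
  have hn1 : (1 : ℝ) ≤ n := by exact_mod_cast hn
  rw [← mul_assoc, ← mul_pow]
  gcongr
  calc ((n : ℝ) + 2) ^ α ≤ ((n : ℝ) + 2) ^ (k : ℝ) :=
        Real.rpow_le_rpow_of_exponent_le (by linarith) hk
    _ = ((n : ℝ) + 2) ^ k := Real.rpow_natCast _ _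
    _ ≤ (3 * n) ^ k := by gcongr; linarith

/-- The normalized monomials `(n + 2)^(α - 2) zⁿ⁺²`. -/
noncomputable def normalizedMonomial (α : ℝ) (n : ℕ) : ℂ[X] :=
  C ((((n : ℝ) + 2) ^ (α - 2) : ℝ) : ℂ) * X ^ (n + 2)

theorem norm_eval_derivative2_normalizedMonomial_le (α : ℝ) (n : ℕ) (z : ℂ) :
    ‖(normalizedMonomial α n).derivative.derivative.eval z‖ ≤ ((n : ℝ) + 2) ^ α * ‖z‖ ^ n := by
  have h1 : (normalizedMonomial α n).derivative.derivative.eval z =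
      (((((n : ℝ) + 2) ^ (α - 2) * (((n : ℝ) + 2) * ((n : ℝ) + 1)) : ℝ)) : ℂ) * z ^ n := by
    simp only [normalizedMonomial, derivative_C_mul, derivative_X_pow, eval_mul, eval_C, eval_pow,
      eval_X]
    simp
    ring
  have h0 : (0 : ℝ) < (n : ℝ) + 2 := by positivity
  rw [h1, norm_mul, norm_pow, Complex.norm_real, Real.norm_eq_abs, abs_of_nonneg (by positivity)]
  gcongr
  have h2 : ((n : ℝ) + 2) ^ α = ((n : ℝ) + 2) ^ (α - 2) * ((n : ℝ) + 2) ^ 2 := by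
    rw [← Real.rpow_natCast ((n : ℝ) + 2) 2, ← Real.rpow_add h0]
    norm_num
  rw [h2]
  gcongr
  nlinarith

variable {α : ℝ}

theorem exists_monomial_bound (hα : 0 < α) : ∃ B, 0 < B ∧ ∀ (β : ℝ) (φ g : ℂ → ℂ),
    DifferentiableOn ℂ φ 𝔻 → Set.MapsTo φ 𝔻 𝔻 → DifferentiableOn ℂ g 𝔻 →
    ∀ T : ZygmundSpace α →L[ℂ] ZygmundSpace β,
    (∀ (f : ZygmundSpace α), ∀ z ∈ 𝔻, T f z = compVolterraU φ g f z) →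
    ∀ ε > 0, ∀ᶠ n : ℕ in Filter.atTop, ∀ z ∈ 𝔻, (n : ℝ) ^ (α - 2) * (stdWeight β z *
      ‖n * symbolU φ g z * φ z ^ (n - 1) + symbolW φ g z * φ z ^ n‖) ≤
        B * (essNorm T + ε) := by
  refine ⟨(2 * α) ^ α * Real.exp 2, by positivity, fun β φ g hφ hm hg T hT ε hε => ?_⟩
  have hT' := eventually_norm_map_le (ι := Unit) hα.le T
    (f := fun n _ => ofPoly hα.le (normalizedMonomial α n)) (B := (2 * α) ^ α * Real.exp 2)
    (fun n _ => ofPoly_mem_littleSubmonoid hα (by simp [normalizedMonomial])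
      (by simp [normalizedMonomial]))
    (fun n _ z hz => by
      rw [deriv2_ofPoly _ _ hz]
      refine (mul_le_mul_of_nonneg_left (norm_eval_derivative2_normalizedMonomial_le α n z)
        (weight_pos α hz).le).trans ?_
      exact rpow_mul_pow_le hα n (norm_nonneg z) (norm_lt_one_of_mem_disk hz))
    (fun ρ hρ δ hδ => by
      filter_upwards [(tendsto_rpow_mul_pow (α := α) (le_max_right ρ 0)
        (max_lt hρ one_pos)).eventually (gt_mem_nhds hδ)] with n hn _ z hz
      have hz1 : z ∈ 𝔻 := by simp; linarith
      rw [deriv2_ofPoly _ _ hz1]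
      refine (norm_eval_derivative2_normalizedMonomial_le α n z).trans (le_trans ?_ hn.le)
      gcongr
      exact hz.trans (le_max_left _ _)) hε
  obtain ⟨N, hN⟩ := Filter.eventually_atTop.1 hT'
  filter_upwards [Filter.eventually_ge_atTop (N + 2)] with n hn z hz
  obtain ⟨k, rfl⟩ := Nat.exists_eq_add_of_le' (show 2 ≤ n by omega)
  have h1 := weight_mul_norm_symbol_le hα.le hφ hm hg T hT (normalizedMonomial α k) hz
  refine le_trans (le_of_eq ?_) (h1.trans (hN k (by omega) ()))
  have h2 : symbolU φ g z * (normalizedMonomial α k).derivative.eval (φ z) +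
      symbolW φ g z * (normalizedMonomial α k).eval (φ z) =
      ((((k : ℝ) + 2) ^ (α - 2) : ℝ) : ℂ) * (((k + 2 : ℕ) : ℂ) * symbolU φ g z *
        φ z ^ (k + 2 - 1) + symbolW φ g z * φ z ^ (k + 2)) := by
    simp only [normalizedMonomial, derivative_C_mul, derivative_X_pow, eval_mul, eval_C, eval_pow,
      eval_X, eval_natCast, map_natCast]
    ring
  rw [h2, norm_mul, Complex.norm_real, Real.norm_eq_abs, abs_of_nonneg (by positivity)]
  push_cast
  ring

/-- The weighted `w` is bounded and carries the factor `n^(α - 2)`, which tends to zero for `α < 2`,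
so the monomial bound isolates `u`. -/
theorem exists_limsupPow_symbolU_le_of_lt_two (hα : 1 < α) (hα2 : α < 2) :
    ∃ C, 0 < C ∧ ∀ (β : ℝ) (φ g : ℂ → ℂ),
    DifferentiableOn ℂ φ 𝔻 → Set.MapsTo φ 𝔻 𝔻 → DifferentiableOn ℂ g 𝔻 →
    ∀ T : ZygmundSpace α →L[ℂ] ZygmundSpace β,
    (∀ (f : ZygmundSpace α), ∀ z ∈ 𝔻, T f z = compVolterraU φ g f z) →
    limsupPow β (fun n => ((n : ℝ) + 1) ^ (α - 1)) (symbolU φ g) φ ≤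
      ENNReal.ofReal C * ENNReal.ofReal (essNorm T) := by
  obtain ⟨B, hB, h⟩ := exists_monomial_bound (by linarith : 0 < α)
  refine ⟨2 * B, by positivity, fun β φ g hφ hm hg T hT => limsupPow_le_mul (by positivity)
    fun ε hε => ?_⟩
  obtain ⟨W, hW0, hW⟩ := exists_symbol_bound (by linarith) hφ hm hg T hT
  have hlim : Filter.Tendsto (fun n : ℕ => ((n : ℝ)) ^ (-(2 - α)) * W) Filter.atTop (nhds 0) := by
    simpa using ((tendsto_rpow_neg_atTop (by linarith : 0 < 2 - α)).comp
      tendsto_natCast_atTop_atTop).mul_const W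
  have hev := (h β φ g hφ hm hg T hT ε hε).and
    (hlim.eventually (gt_mem_nhds (show 0 < B * ε by positivity)))
  filter_upwards [(Filter.tendsto_add_atTop_nat 1).eventually hev] with n hn z hz
  obtain ⟨h1, h2⟩ := hn
  have h1 := h1 z hz
  rw [show -(2 - α) = α - 2 by ring] at h2
  rw [Nat.add_sub_cancel] at h1
  push_cast at h1 h2
  have hn0 : (0 : ℝ) < (n : ℝ) + 1 := by positivity
  set a := ((n : ℝ) + 1) ^ (α - 2) with ha
  have ha0 : 0 < a := Real.rpow_pos_of_pos hn0 _
  have h3 : ((n : ℝ) + 1) ^ (α - 1) = a * ((n : ℝ) + 1) := by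
    rw [ha, ← Real.rpow_add_one hn0.ne']
    congr 1
    ring
  have hv := weight_pos β hz
  have h4 : ((n : ℝ) + 1) * ‖symbolU φ g z * φ z ^ n‖ ≤
      ‖((n : ℂ) + 1) * symbolU φ g z * φ z ^ n + symbolW φ g z * φ z ^ (n + 1)‖ +
        ‖symbolW φ g z‖ := by
    have h5 := norm_sub_le (((n : ℂ) + 1) * symbolU φ g z * φ z ^ n +
      symbolW φ g z * φ z ^ (n + 1)) (symbolW φ g z * φ z ^ (n + 1))
    have h6 : ‖(n : ℂ) + 1‖ = (n : ℝ) + 1 := by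
      exact_mod_cast Complex.norm_natCast (n + 1)
    have h7 : ‖φ z ^ (n + 1)‖ ≤ 1 := by
      rw [norm_pow]
      exact pow_le_one₀ (norm_nonneg _) (norm_lt_one_of_mem_disk (hm hz)).le
    rw [add_sub_cancel_right, mul_assoc, norm_mul, h6,
      norm_mul (symbolW φ g z) (φ z ^ (n + 1))] at h5
    have h8 := mul_le_mul_of_nonneg_left h7 (norm_nonneg (symbolW φ g z))
    rw [← mul_assoc] at h5
    linarith
  have h5 := mul_le_mul_of_nonneg_left h4 (mul_nonneg ha0.le hv.le)
  have h6 := mul_le_mul_of_nonneg_left (hW z hz).2 ha0.le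
  have h7 : 0 ≤ B * essNorm T := mul_nonneg hB.le (essNorm_nonneg T)
  rw [h3]
  linarith

/-- The bounds in degrees `n` and `2n` are combined: subtracting `φⁿ` times the first expression
from the second cancels `w` and leaves `n u φ²ⁿ⁻¹`. -/
theorem exists_eventually_symbolU_le (hα : 2 ≤ α) :
    ∃ C, 0 < C ∧ ∀ (β : ℝ) (φ g : ℂ → ℂ),
    DifferentiableOn ℂ φ 𝔻 → Set.MapsTo φ 𝔻 𝔻 → DifferentiableOn ℂ g 𝔻 →
    ∀ T : ZygmundSpace α →L[ℂ] ZygmundSpace β,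
    (∀ (f : ZygmundSpace α), ∀ z ∈ 𝔻, T f z = compVolterraU φ g f z) →
    ∀ ε > 0, ∀ᶠ n : ℕ in Filter.atTop, ∀ z ∈ 𝔻,
      ((n : ℝ) + 1) ^ (α - 1) * (stdWeight β z * ‖symbolU φ g z * φ z ^ n‖) ≤
        C * (essNorm T + ε) := by
  obtain ⟨B, hB, h⟩ := exists_monomial_bound (by linarith : 0 < α)
  refine ⟨3 ^ (α - 1) * (2 * B), by positivity, fun β φ g hφ hm hg T hT ε hε => ?_⟩
  obtain ⟨N, hN⟩ := Filter.eventually_atTop.1 (h β φ g hφ hm hg T hT ε hε)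
  filter_upwards [Filter.eventually_ge_atTop (2 * N + 1)] with k hk z hz
  -- Then `2n - 1 ≤ k ≤ 3n - 1`: the powers of `φ` compare one way and the weights compare up to
  -- `3^(α - 1)`.
  set n := (k + 1) / 2 with hn
  have hnN : N ≤ n := by omega
  have hn1 : 1 ≤ n := by omega
  have hnk : 2 * n - 1 ≤ k := by omega
  have hkn : k + 1 ≤ 3 * n := by omega
  have h1 := hN n hnN z hz
  have h2 := hN (2 * n) (by omega) z hz
  set E := B * (essNorm T + ε) with hE
  have hn0 : (0 : ℝ) < n := by exact_mod_cast hn1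
  have hv := weight_pos β hz
  have hφ1 := (norm_lt_one_of_mem_disk (hm hz)).le
  set u := symbolU φ g z
  set w := symbolW φ g z
  set a := (n : ℂ) * u * φ z ^ (n - 1) + w * φ z ^ n with ha
  set b := ((2 * n : ℕ) : ℂ) * u * φ z ^ (2 * n - 1) + w * φ z ^ (2 * n) with hb
  have h3 : (n : ℂ) * (u * φ z ^ (2 * n - 1)) = b - φ z ^ n * a := by
    have e1 : φ z ^ (2 * n - 1) = φ z ^ n * φ z ^ (n - 1) := by
      rw [← pow_add]; congr 1; omega
    rw [ha, hb, e1, two_mul n, pow_add]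
    push_cast
    ring
  have h4 : n * ‖u * φ z ^ (2 * n - 1)‖ ≤ ‖b‖ + ‖a‖ := by
    have e1 := norm_sub_le b (φ z ^ n * a)
    rw [← h3, norm_mul, Complex.norm_natCast, norm_mul (φ z ^ n) a, norm_pow] at e1
    have e2 := mul_le_mul_of_nonneg_right (pow_le_one₀ (norm_nonneg (φ z)) hφ1 (n := n))
      (norm_nonneg a)
    linarith
  have h5 : ‖u * φ z ^ k‖ ≤ ‖u * φ z ^ (2 * n - 1)‖ := by
    rw [norm_mul, norm_mul, norm_pow, norm_pow]
    exact mul_le_mul_of_nonneg_left (pow_le_pow_of_le_one (norm_nonneg _) hφ1 hnk) (norm_nonneg _)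
  set c := (n : ℝ) ^ (α - 2) with hc
  have hc0 : 0 < c := Real.rpow_pos_of_pos hn0 _
  have h6 : c ≤ ((2 * n : ℕ) : ℝ) ^ (α - 2) :=
    Real.rpow_le_rpow hn0.le (by push_cast; linarith) (by linarith)
  have h7 : c * (stdWeight β z * ‖b‖) ≤ E :=
    (mul_le_mul_of_nonneg_right h6 (by positivity)).trans h2
  have h8 : ((k : ℝ) + 1) ^ (α - 1) ≤ 3 ^ (α - 1) * (c * n) := by
    have e1 : c * n = (n : ℝ) ^ (α - 1) := by
      rw [hc, ← Real.rpow_add_one hn0.ne']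
      congr 1
      ring
    rw [e1, ← Real.mul_rpow (by norm_num) hn0.le]
    exact Real.rpow_le_rpow (by positivity) (by exact_mod_cast hkn) (by linarith)
  have h9 : c * n * (stdWeight β z * ‖u * φ z ^ k‖) ≤ 2 * E := by
    have e1 := mul_le_mul_of_nonneg_left h5 (by positivity : 0 ≤ c * stdWeight β z * n)
    have e2 := mul_le_mul_of_nonneg_left h4 (by positivity : 0 ≤ c * stdWeight β z)
    linarith
  calc ((k : ℝ) + 1) ^ (α - 1) * (stdWeight β z * ‖u * φ z ^ k‖)
      ≤ 3 ^ (α - 1) * (c * n) * (stdWeight β z * ‖u * φ z ^ k‖) :=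
        mul_le_mul_of_nonneg_right h8 (by positivity)
    _ = 3 ^ (α - 1) * (c * n * (stdWeight β z * ‖u * φ z ^ k‖)) := by ring
    _ ≤ 3 ^ (α - 1) * (2 * E) := by gcongr
    _ = 3 ^ (α - 1) * (2 * B) * (essNorm T + ε) := by rw [hE]; ring

theorem exists_limsupPow_symbolU_le (hα : 2 ≤ α) :
    ∃ C, 0 < C ∧ ∀ (β : ℝ) (φ g : ℂ → ℂ),
    DifferentiableOn ℂ φ 𝔻 → Set.MapsTo φ 𝔻 𝔻 → DifferentiableOn ℂ g 𝔻 →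
    ∀ T : ZygmundSpace α →L[ℂ] ZygmundSpace β,
    (∀ (f : ZygmundSpace α), ∀ z ∈ 𝔻, T f z = compVolterraU φ g f z) →
    limsupPow β (fun n => ((n : ℝ) + 1) ^ (α - 1)) (symbolU φ g) φ ≤
      ENNReal.ofReal C * ENNReal.ofReal (essNorm T) := by
  obtain ⟨C, hC, h⟩ := exists_eventually_symbolU_le hα
  exact ⟨C, hC, fun β φ g hφ hm hg T hT => limsupPow_le_mul hC (h β φ g hφ hm hg T hT)⟩

theorem exists_limsupPow_symbolW_le (hα : 2 ≤ α) :
    ∃ C, 0 < C ∧ ∀ (β : ℝ) (φ g : ℂ → ℂ),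
    DifferentiableOn ℂ φ 𝔻 → Set.MapsTo φ 𝔻 𝔻 → DifferentiableOn ℂ g 𝔻 →
    ∀ T : ZygmundSpace α →L[ℂ] ZygmundSpace β,
    (∀ (f : ZygmundSpace α), ∀ z ∈ 𝔻, T f z = compVolterraU φ g f z) →
    limsupPow β (fun n => ((n : ℝ) + 1) ^ (α - 2)) (symbolW φ g) φ ≤
      ENNReal.ofReal C * ENNReal.ofReal (essNorm T) := by
  obtain ⟨B, hB, h⟩ := exists_monomial_bound (by linarith : 0 < α)
  obtain ⟨C, hC, hu⟩ := exists_eventually_symbolU_le hα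
  refine ⟨2 ^ (α - 2) * (B + C), by positivity, fun β φ g hφ hm hg T hT => limsupPow_le_mul
    (by positivity) fun ε hε => ?_⟩
  -- The monomial bound contains `n u φⁿ⁻¹`, so the estimate for `u` is used in degree `n - 1`.
  have hev := (Filter.tendsto_sub_atTop_nat 1).eventually (hu β φ g hφ hm hg T hT ε hε)
  filter_upwards [h β φ g hφ hm hg T hT ε hε, hev, Filter.eventually_ge_atTop 1]
    with n h1 h2 hn z hz
  have h1 := h1 z hz
  have h2 := h2 z hz
  have hn1 : (1 : ℝ) ≤ n := by exact_mod_cast hn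
  have hv := weight_pos β hz
  rw [Nat.cast_sub hn, Nat.cast_one, sub_add_cancel] at h2
  set u := symbolU φ g z
  set w := symbolW φ g z
  set c := (n : ℝ) ^ (α - 2) with hc
  have hc0 : 0 < c := Real.rpow_pos_of_pos (by linarith) _
  have h3 : (n : ℝ) ^ (α - 1) = c * n := by
    rw [hc, ← Real.rpow_add_one (by linarith)]
    congr 1
    ring
  have h4 : ((n : ℝ) + 1) ^ (α - 2) ≤ 2 ^ (α - 2) * c := by
    rw [hc, ← Real.mul_rpow zero_le_two (by linarith)]
    exact Real.rpow_le_rpow (by positivity) (by linarith) (by linarith)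
  have h5 : ‖w * φ z ^ n‖ ≤ ‖n * u * φ z ^ (n - 1) + w * φ z ^ n‖ +
      n * ‖u * φ z ^ (n - 1)‖ := by
    have e1 := norm_sub_le (n * u * φ z ^ (n - 1) + w * φ z ^ n) (n * u * φ z ^ (n - 1))
    rw [add_sub_cancel_left] at e1
    refine e1.trans (le_of_eq ?_)
    rw [mul_assoc, norm_mul (n : ℂ), Complex.norm_natCast]
  have h6 : c * (stdWeight β z * ‖w * φ z ^ n‖) ≤ (B + C) * (essNorm T + ε) := by
    have e1 := mul_le_mul_of_nonneg_left h5 (by positivity : 0 ≤ c * stdWeight β z)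
    rw [h3] at h2
    linarith
  calc ((n : ℝ) + 1) ^ (α - 2) * (stdWeight β z * ‖w * φ z ^ n‖)
      ≤ 2 ^ (α - 2) * c * (stdWeight β z * ‖w * φ z ^ n‖) :=
        mul_le_mul_of_nonneg_right h4 (by positivity)
    _ = 2 ^ (α - 2) * (c * (stdWeight β z * ‖w * φ z ^ n‖)) := by ring
    _ ≤ 2 ^ (α - 2) * ((B + C) * (essNorm T + ε)) := by gcongr
    _ = 2 ^ (α - 2) * (B + C) * (essNorm T + ε) := by ring

end Monomials

/-! ### Lower bounds with logarithmic weights -/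

section Logarithmic

open ZygmundSpace Polynomial

/-- Polynomials with second derivative `∑ (j + 1) aⱼ cʲ⁺¹ zʲ`, `m ≤ j < m²`. -/
noncomputable def blockPoly (a : ℕ → ℝ) (m : ℕ) (c : ℂ) : ℂ[X] :=
  ∑ j ∈ Finset.Ico m (m ^ 2), C (c ^ (j + 1) * (a j / (j + 2) : ℝ)) * X ^ (j + 2)

variable {a : ℕ → ℝ} {m : ℕ} {c : ℂ}

theorem eval_blockPoly (z : ℂ) : (blockPoly a m c).eval z =
    ∑ j ∈ Finset.Ico m (m ^ 2), c ^ (j + 1) * (a j / (j + 2) : ℝ) * z ^ (j + 2) := by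
  simp [blockPoly, eval_finsetSum]

theorem eval_derivative_blockPoly (z : ℂ) : (blockPoly a m c).derivative.eval z =
    ∑ j ∈ Finset.Ico m (m ^ 2), (a j : ℂ) * (c * z) ^ (j + 1) := by
  rw [blockPoly, derivative_sum, eval_finsetSum]
  refine Finset.sum_congr rfl fun j _ => ?_
  have h : (j : ℂ) + 2 ≠ 0 := by exact_mod_cast (by omega : j + 2 ≠ 0)
  simp only [derivative_C_mul, derivative_X_pow, eval_mul, eval_C, eval_pow, eval_X, mul_pow]
  push_cast
  field_simp

theorem eval_derivative2_blockPoly (z : ℂ) : (blockPoly a m c).derivative.derivative.eval z =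
    ∑ j ∈ Finset.Ico m (m ^ 2), c ^ (j + 1) * (a j * (j + 1) : ℝ) * z ^ j := by
  rw [blockPoly, derivative_sum, derivative_sum, eval_finsetSum]
  refine Finset.sum_congr rfl fun j _ => ?_
  have h : (j : ℂ) + 2 ≠ 0 := by exact_mod_cast (by omega : j + 2 ≠ 0)
  simp only [derivative_C_mul, derivative_X_pow, eval_mul, eval_C, eval_pow, eval_X]
  push_cast
  field_simp

theorem norm_eval_derivative2_blockPoly_le (ha : ∀ j, 0 ≤ a j) (hc : ‖c‖ = 1) {z : ℂ} {x : ℝ}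
    (hx : ‖z‖ ≤ x) : ‖(blockPoly a m c).derivative.derivative.eval z‖ ≤
      ∑ j ∈ Finset.Ico m (m ^ 2), a j * (j + 1) * x ^ j := by
  rw [eval_derivative2_blockPoly]
  refine norm_sum_le_of_le _ fun j _ => ?_
  have := ha j
  rw [norm_mul, norm_mul, norm_pow, norm_pow, hc, one_pow, one_mul, Complex.norm_real,
    Real.norm_eq_abs, abs_of_nonneg (by positivity)]
  gcongr

theorem sum_Ico_succ_mul_pow_le {x : ℝ} (hx0 : 0 ≤ x) (hx : x < 1) (m M : ℕ) :
    ∑ j ∈ Finset.Ico m M, ((j : ℝ) + 1) * x ^ j ≤ 1 / (1 - x) ^ 2 := by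
  have h := hasSum_choose_mul_geometric_of_norm_lt_one 1
    (by rwa [Real.norm_eq_abs, abs_of_nonneg hx0] : ‖x‖ < 1)
  simp only [Nat.choose_one_right, Nat.cast_add, Nat.cast_one] at h
  exact sum_le_hasSum _ (fun j _ => by positivity) h

/-- Splitting `xʲ = √xʲ · √xʲ`, one factor gives decay in `m` and the other keeps the series
convergent. -/
theorem sum_Ico_succ_mul_pow_le_sqrt {x : ℝ} (hx0 : 0 ≤ x) (hx : x < 1) (m M : ℕ) :
    ∑ j ∈ Finset.Ico m M, ((j : ℝ) + 1) * x ^ j ≤ √x ^ m * (1 / (1 - √x) ^ 2) := by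
  have hs0 := Real.sqrt_nonneg x
  have hs1 : √x < 1 := by rwa [Real.sqrt_lt' one_pos, one_pow]
  refine le_trans ?_ (mul_le_mul_of_nonneg_left (sum_Ico_succ_mul_pow_le hs0 hs1 m M)
    (pow_nonneg hs0 m))
  rw [Finset.mul_sum]
  refine Finset.sum_le_sum fun j hj => ?_
  have h1 : x ^ j = √x ^ j * √x ^ j := by rw [← mul_pow, Real.mul_self_sqrt hx0]
  have h2 := pow_le_pow_of_le_one hs0 hs1.le (Finset.mem_Ico.1 hj).1
  rw [h1]
  have h3 := mul_le_mul_of_nonneg_right h2 (show 0 ≤ ((j : ℝ) + 1) * √x ^ j by positivity)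
  linarith

theorem exists_norm_eq_one_mul_eq (z : ℂ) : ∃ c : ℂ, ‖c‖ = 1 ∧ c * z = ‖z‖ := by
  by_cases hz : z = 0
  · exact ⟨1, by simp, by simp [hz]⟩
  · have h : (‖z‖ : ℂ) ≠ 0 := by simpa using hz
    refine ⟨‖z‖ / z, ?_, div_mul_cancel₀ _ hz⟩
    rw [norm_div, Complex.norm_real, norm_norm, div_self (norm_ne_zero_iff.2 hz)]

/-- Harmonic numbers give at least `2 log m - (1 + log m)`, which is at least `log m / 2` once `log
m ≥ 2`. -/
theorem eventually_log_le_sum :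
    ∀ᶠ m : ℕ in Filter.atTop, Real.log m / 2 ≤ ∑ j ∈ Finset.Ico m (m ^ 2), ((j : ℝ) + 1)⁻¹ := by
  have h := (Real.tendsto_log_atTop.comp tendsto_natCast_atTop_atTop).eventually_ge_atTop 2
  filter_upwards [h, Filter.eventually_ge_atTop 1] with m hm hm1
  simp only [Function.comp_apply] at hm
  have hmm : m ≤ m ^ 2 := Nat.le_self_pow two_ne_zero m
  have hH : ∀ n : ℕ, ((harmonic n : ℚ) : ℝ) = ∑ j ∈ Finset.range n, ((j : ℝ) + 1)⁻¹ := by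
    intro n
    simp [harmonic]
  rw [Finset.sum_Ico_eq_sub _ hmm, ← hH, ← hH]
  have h1 := log_add_one_le_harmonic (m ^ 2)
  have h2 := harmonic_le_one_add_log m
  have h3 : 2 * Real.log m ≤ Real.log ((m ^ 2 + 1 : ℕ) : ℝ) := by
    have : 2 * Real.log m = Real.log ((m : ℝ) ^ 2) := by rw [Real.log_pow]; norm_num
    rw [this]
    have hm0 : (0 : ℝ) < m := by exact_mod_cast hm1
    exact Real.log_le_log (by positivity) (by push_cast; linarith)
  linarith

/-- The block `[m, m²)` attached to a degree `n`, with `m = ⌊√n⌋ - 1`. -/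
theorem tendsto_sqrt_sub_one :
    Filter.Tendsto (fun n : ℕ => Nat.sqrt n - 1) Filter.atTop Filter.atTop := by
  refine Filter.tendsto_atTop.2 fun b => ?_
  filter_upwards [Filter.eventually_ge_atTop ((b + 1) * (b + 1))] with n hn
  have := Nat.le_sqrt.2 hn
  omega

/-- With `m` the start of the block, `m² + 1 ≤ n` keeps the exponents `j + 1` and `j + 2` at most
`n`, while `n ≤ m⁴` makes `log n` and `log m` comparable. -/
theorem eventually_sqrt_sub_one : ∀ᶠ n : ℕ in Filter.atTop,
    (Nat.sqrt n - 1) ^ 2 + 1 ≤ n ∧ Real.log n ≤ 4 * Real.log ((Nat.sqrt n - 1 : ℕ) : ℝ) := by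
  filter_upwards [tendsto_sqrt_sub_one.eventually_ge_atTop 2, Filter.eventually_ge_atTop 1]
    with n hn hn1
  have h1 : Nat.sqrt n * Nat.sqrt n ≤ n := Nat.sqrt_le n
  have h2 : n < (Nat.sqrt n + 1) * (Nat.sqrt n + 1) := Nat.lt_succ_sqrt n
  obtain ⟨m, hm⟩ : ∃ m, m = Nat.sqrt n - 1 := ⟨_, rfl⟩
  have hs : Nat.sqrt n = m + 1 := by omega
  rw [← hm] at hn ⊢
  rw [hs] at h1 h2
  refine ⟨by nlinarith, ?_⟩
  have h3 : (n : ℝ) ≤ (m : ℝ) ^ 4 := by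
    have : n ≤ m ^ 4 := by nlinarith [Nat.mul_le_mul hn hn, Nat.mul_le_mul hn (le_refl m)]
    exact_mod_cast this
  have h4 : 4 * Real.log m = Real.log ((m : ℝ) ^ 4) := by rw [Real.log_pow]; norm_num
  rw [h4]
  exact Real.log_le_log (by exact_mod_cast hn1) h3

theorem sum_Ico_inv_mul_succ_le (m M : ℕ) (hm : 1 ≤ m) :
    ∑ j ∈ Finset.Ico m M, (1 / (((j : ℝ) + 1) * ((j : ℝ) + 2))) ≤ 1 / (m : ℝ) := by
  have hm0 : (0 : ℝ) < m := by exact_mod_cast hm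
  rcases le_or_gt m M with h | h
  · have key : ∀ M, m ≤ M → ∑ j ∈ Finset.Ico m M, (1 / (((j : ℝ) + 1) * ((j : ℝ) + 2))) =
        1 / ((m : ℝ) + 1) - 1 / ((M : ℝ) + 1) := by
      intro M hM
      induction M, hM using Nat.le_induction with
      | base => simp
      | succ M hM ih =>
        rw [Finset.sum_Ico_succ_top hM, ih]
        push_cast
        field_simp
        ring
    rw [key M h]
    have h1 : 0 ≤ 1 / ((M : ℝ) + 1) := by positivity
    have h2 : 1 / ((m : ℝ) + 1) ≤ 1 / m := one_div_le_one_div_of_le hm0 (by linarith)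
    linarith
  · rw [Finset.Ico_eq_empty (by omega), Finset.sum_empty]
    positivity

/-- Uniformity over unimodular `c` is essential, because the rotation is later chosen depending on
the point `z`. -/
theorem eventually_block_bound {α : ℝ} (hα : 0 < α) (ha : ∀ j, 0 ≤ a j) {B : ℝ}
    (hB : ∀ m (x : ℝ), 0 ≤ x → x < 1 →
      (1 - x ^ 2) ^ α * ∑ j ∈ Finset.Ico m (m ^ 2), a j * (j + 1) * x ^ j ≤ B)
    (hloc : ∀ x : ℝ, 0 ≤ x → x < 1 → Filter.Tendsto
      (fun m : ℕ => ∑ j ∈ Finset.Ico m (m ^ 2), a j * (j + 1) * x ^ j) Filter.atTop (nhds 0))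
    {β : ℝ} {φ g : ℂ → ℂ} (hφ : DifferentiableOn ℂ φ 𝔻) (hm : Set.MapsTo φ 𝔻 𝔻)
    (hg : DifferentiableOn ℂ g 𝔻) (T : ZygmundSpace α →L[ℂ] ZygmundSpace β)
    (hT : ∀ (f : ZygmundSpace α), ∀ z ∈ 𝔻, T f z = compVolterraU φ g f z) {ε : ℝ} (hε : 0 < ε) :
    ∀ᶠ m : ℕ in Filter.atTop, ∀ c : ℂ, ‖c‖ = 1 → ∀ z ∈ 𝔻,
      stdWeight β z * ‖symbolU φ g z * (blockPoly a m c).derivative.eval (φ z) +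
        symbolW φ g z * (blockPoly a m c).eval (φ z)‖ ≤ B * (essNorm T + ε) := by
  have : Nonempty {c : ℂ // ‖c‖ = 1} := ⟨⟨1, by simp⟩⟩
  have hT' := eventually_norm_map_le (ι := {c : ℂ // ‖c‖ = 1}) hα.le T
    (f := fun m c => ofPoly hα.le (blockPoly a m c)) (B := B)
    (fun m c => ofPoly_mem_littleSubmonoid hα (by simp [eval_blockPoly])
      (by simp [eval_derivative_blockPoly]))
    (fun m c z hz => by
      rw [deriv2_ofPoly _ _ hz]
      exact (mul_le_mul_of_nonneg_left (norm_eval_derivative2_blockPoly_le ha c.2 le_rfl)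
        (weight_pos α hz).le).trans (hB m _ (norm_nonneg z) (norm_lt_one_of_mem_disk hz)))
    (fun ρ hρ δ hδ => by
      filter_upwards [(hloc _ (le_max_right ρ 0)
        (max_lt hρ one_pos)).eventually (gt_mem_nhds hδ)] with m hn c z hz
      have hz1 : z ∈ 𝔻 := by simp; linarith
      rw [deriv2_ofPoly _ _ hz1]
      exact (norm_eval_derivative2_blockPoly_le ha c.2 (hz.trans (le_max_left _ _))).trans
        hn.le) hε
  filter_upwards [hT'] with m hm' c hc z hz
  exact (weight_mul_norm_symbol_le hα.le hφ hm hg T hT (blockPoly a m c) hz).trans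
    (hm' ⟨c, hc⟩)

/-- The coefficients `1 / (j + 1)` make the second derivative a geometric block, the first
derivative at `φ(z)` at least `(log m / 2)|φ(z)|ⁿ`, and the value at most `1 / m`. Hence only `u`
survives. -/
theorem exists_limsupPow_log_symbolU_le : ∃ C, 0 < C ∧ ∀ (β : ℝ) (φ g : ℂ → ℂ),
    DifferentiableOn ℂ φ 𝔻 → Set.MapsTo φ 𝔻 𝔻 → DifferentiableOn ℂ g 𝔻 →
    ∀ T : ZygmundSpace 1 →L[ℂ] ZygmundSpace β,
    (∀ (f : ZygmundSpace 1), ∀ z ∈ 𝔻, T f z = compVolterraU φ g f z) →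
    limsupPow β (fun n => Real.log n) (symbolU φ g) φ ≤
      ENNReal.ofReal C * ENNReal.ofReal (essNorm T) := by
  refine ⟨24, by norm_num, fun β φ g hφ hm hg T hT => limsupPow_le_mul (by norm_num)
    fun ε hε => ?_⟩
  obtain ⟨W, hW0, hW⟩ := exists_symbol_bound zero_le_one hφ hm hg T hT
  have hsum : ∀ (m : ℕ) (x : ℝ), 0 ≤ x → x < 1 → ∑ j ∈ Finset.Ico m (m ^ 2),
      ((j : ℝ) + 1)⁻¹ * (j + 1) * x ^ j ≤ x ^ m / (1 - x) := by
    intro m x hx0 hx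
    refine le_trans (le_of_eq (Finset.sum_congr rfl fun j _ => ?_))
      (geom_sum_Ico_le_of_lt_one hx0 hx)
    rw [inv_mul_cancel₀ (by positivity), one_mul]
  have hblock := eventually_block_bound (a := fun j => ((j : ℝ) + 1)⁻¹) (B := 2) one_pos
    (fun j => by positivity)
    (fun m x hx0 hx => by
      rw [Real.rpow_one]
      have h1 : x ^ m ≤ 1 := pow_le_one₀ hx0 hx.le
      have h2 : 0 < 1 - x := by linarith
      calc (1 - x ^ 2) * ∑ j ∈ Finset.Ico m (m ^ 2), ((j : ℝ) + 1)⁻¹ * (j + 1) * x ^ j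
          ≤ (1 - x ^ 2) * (x ^ m / (1 - x)) :=
            mul_le_mul_of_nonneg_left (hsum m x hx0 hx) (by nlinarith)
        _ = (1 + x) * x ^ m := by field_simp; ring
        _ ≤ 2 := by nlinarith [pow_nonneg hx0 m])
    (fun x hx0 hx => by
      refine squeeze_zero (fun m => Finset.sum_nonneg fun j _ => by positivity)
        (fun m => hsum m x hx0 hx) ?_
      simpa using (tendsto_pow_atTop_nhds_zero_of_lt_one hx0 hx).div_const (1 - x))
    hφ hm hg T hT hε
  have hWlim : ∀ᶠ m : ℕ in Filter.atTop, W * (1 / (m : ℝ)) ≤ ε := by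
    have : Filter.Tendsto (fun m : ℕ => W * (1 / (m : ℝ))) Filter.atTop (nhds 0) := by
      simpa using tendsto_one_div_atTop_nhds_zero_nat.const_mul W
    filter_upwards [this.eventually (gt_mem_nhds hε)] with m hm using hm.le
  have hall := hblock.and (hWlim.and (eventually_log_le_sum.and (Filter.eventually_ge_atTop 1)))
  filter_upwards [tendsto_sqrt_sub_one.eventually hall, eventually_sqrt_sub_one]
    with n hn hn' z hz
  obtain ⟨hn1, hn2⟩ := hn'
  set m := Nat.sqrt n - 1
  obtain ⟨h1, h2, h3, hm1⟩ := hn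
  obtain ⟨c, hc, hcz⟩ := exists_norm_eq_one_mul_eq (φ z)
  have h1 := h1 c hc z hz
  have hv := weight_pos β hz
  have hx0 := norm_nonneg (φ z)
  have hx := norm_lt_one_of_mem_disk (hm hz)
  set u := symbolU φ g z
  set w := symbolW φ g z
  set x := ‖φ z‖
  have h4 : ‖(blockPoly (fun j => ((j : ℝ) + 1)⁻¹) m c).eval (φ z)‖ ≤ 1 / (m : ℝ) := by
    rw [eval_blockPoly]
    refine (norm_sum_le_of_le _ fun j _ => ?_).trans (sum_Ico_inv_mul_succ_le m (m ^ 2) hm1)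
    rw [norm_mul, norm_mul, norm_pow, norm_pow, hc, one_pow, one_mul, Complex.norm_real,
      Real.norm_eq_abs, abs_of_nonneg (by positivity)]
    refine (mul_le_of_le_one_right (by positivity) (pow_le_one₀ hx0 hx.le)).trans (le_of_eq ?_)
    field_simp
  have h5 : Real.log m / 2 * x ^ n ≤
      ‖(blockPoly (fun j => ((j : ℝ) + 1)⁻¹) m c).derivative.eval (φ z)‖ := by
    rw [eval_derivative_blockPoly, hcz]
    have e1 : (∑ j ∈ Finset.Ico m (m ^ 2), ((((j : ℝ) + 1)⁻¹ : ℝ) : ℂ) * (x : ℂ) ^ (j + 1)) =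
        ((∑ j ∈ Finset.Ico m (m ^ 2), ((j : ℝ) + 1)⁻¹ * x ^ (j + 1) : ℝ) : ℂ) := by
      push_cast
      rfl
    rw [e1, Complex.norm_real, Real.norm_eq_abs,
      abs_of_nonneg (Finset.sum_nonneg fun j _ => by positivity)]
    refine (mul_le_mul_of_nonneg_right h3 (pow_nonneg hx0 n)).trans ?_
    rw [Finset.sum_mul]
    refine Finset.sum_le_sum fun j hj => mul_le_mul_of_nonneg_left ?_ (by positivity)
    have := (Finset.mem_Ico.1 hj).2
    exact pow_le_pow_of_le_one hx0 hx.le (by omega)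
  set p := (blockPoly (fun j => ((j : ℝ) + 1)⁻¹) m c).eval (φ z)
  set q := (blockPoly (fun j => ((j : ℝ) + 1)⁻¹) m c).derivative.eval (φ z)
  have h6 : ‖u‖ * ‖q‖ ≤ ‖u * q + w * p‖ + ‖w‖ * ‖p‖ := by
    have := norm_sub_le (u * q + w * p) (w * p)
    rwa [add_sub_cancel_right, norm_mul, norm_mul] at this
  have h7 : stdWeight β z * ‖w‖ * ‖p‖ ≤ ε :=
    (mul_le_mul (hW z hz).2 h4 (norm_nonneg _) hW0).trans h2
  have h8 := mul_le_mul_of_nonneg_left h6 hv.le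
  have h9 := mul_le_mul_of_nonneg_left h5 (by positivity : 0 ≤ stdWeight β z * ‖u‖)
  have h10 := mul_le_mul_of_nonneg_right hn2
    (by positivity : 0 ≤ stdWeight β z * ‖u‖ * x ^ n)
  have h11 := essNorm_nonneg T
  rw [norm_mul, norm_pow]
  linarith

/-- Unit coefficients move the harmonic sum from the derivative to the value. The derivative is now
a geometric block, and its product with `u` is absorbed by the known bound on `u`. -/
theorem exists_limsupPow_log_symbolW_le : ∃ C, 0 < C ∧ ∀ (β : ℝ) (φ g : ℂ → ℂ),
    DifferentiableOn ℂ φ 𝔻 → Set.MapsTo φ 𝔻 𝔻 → DifferentiableOn ℂ g 𝔻 →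
    ∀ T : ZygmundSpace 2 →L[ℂ] ZygmundSpace β,
    (∀ (f : ZygmundSpace 2), ∀ z ∈ 𝔻, T f z = compVolterraU φ g f z) →
    limsupPow β (fun n => Real.log n) (symbolW φ g) φ ≤
      ENNReal.ofReal C * ENNReal.ofReal (essNorm T) := by
  obtain ⟨D, hD, hu⟩ := exists_eventually_symbolU_le (le_refl (2 : ℝ))
  refine ⟨16 * (4 + 4 * D), by positivity, fun β φ g hφ hm hg T hT => limsupPow_le_mul
    (by positivity) fun ε hε => ?_⟩
  have hblock := eventually_block_bound (a := fun _ => 1) (B := 4) two_pos (fun _ => zero_le_one)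
    (fun m x hx0 hx => by
      simp only [one_mul]
      have h2 : 0 < 1 - x := by linarith
      rw [show (2 : ℝ) = ((2 : ℕ) : ℝ) by norm_num, Real.rpow_natCast]
      calc (1 - x ^ 2) ^ 2 * ∑ j ∈ Finset.Ico m (m ^ 2), ((j : ℝ) + 1) * x ^ j
          ≤ (1 - x ^ 2) ^ 2 * (1 / (1 - x) ^ 2) :=
            mul_le_mul_of_nonneg_left (sum_Ico_succ_mul_pow_le hx0 hx _ _) (by positivity)
        _ = (1 + x) ^ 2 := by field_simp; ring
        _ ≤ 4 := by nlinarith)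
    (fun x hx0 hx => by
      simp only [one_mul]
      refine squeeze_zero (fun m => Finset.sum_nonneg fun j _ => by positivity)
        (fun m => sum_Ico_succ_mul_pow_le_sqrt hx0 hx _ _) ?_
      have h := (tendsto_pow_atTop_nhds_zero_of_lt_one (Real.sqrt_nonneg x)
        (by rwa [Real.sqrt_lt' one_pos, one_pow])).mul_const (1 / (1 - √x) ^ 2)
      rwa [zero_mul] at h)
    hφ hm hg T hT hε
  obtain ⟨N, hN⟩ := Filter.eventually_atTop.1 (hu β φ g hφ hm hg T hT ε hε)
  have hall := hblock.and (eventually_log_le_sum.and (Filter.eventually_ge_atTop N))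
  filter_upwards [tendsto_sqrt_sub_one.eventually hall, eventually_sqrt_sub_one]
    with n hn hn' z hz
  obtain ⟨hn1, hn2⟩ := hn'
  set m := Nat.sqrt n - 1
  obtain ⟨h1, h3, hmN⟩ := hn
  obtain ⟨c, hc, hcz⟩ := exists_norm_eq_one_mul_eq (φ z)
  have h1 := h1 c hc z hz
  have hv := weight_pos β hz
  have hx0 := norm_nonneg (φ z)
  have hx := norm_lt_one_of_mem_disk (hm hz)
  -- The factor `xᵐ (1 - x)⁻¹` bounding the derivative is replaced by `(k + 1) xᵏ` with `k ≥ m`, a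
  -- weight for which `u` is already controlled.
  obtain ⟨k, hk, hkx⟩ := exists_pow_mul_inv_le hx0 hx m
  have h2 := hN k (hmN.trans hk) z hz
  rw [show (2 : ℝ) - 1 = 1 by norm_num, Real.rpow_one, norm_mul, norm_pow] at h2
  set u := symbolU φ g z
  set w := symbolW φ g z
  set x := ‖φ z‖
  have h4 : ‖(blockPoly (fun _ => 1) m c).derivative.eval (φ z)‖ ≤ x ^ m * (1 - x)⁻¹ := by
    rw [eval_derivative_blockPoly, ← div_eq_mul_inv]
    refine (norm_sum_le_of_le _ fun j _ => ?_).trans (geom_sum_Ico_le_of_lt_one hx0 hx)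
    rw [hcz, Complex.ofReal_one, one_mul, norm_pow, Complex.norm_real, norm_norm]
    exact pow_le_pow_of_le_one hx0 hx.le (Nat.le_succ j)
  have h5 : Real.log m / 4 * x ^ n ≤ ‖(blockPoly (fun _ => 1) m c).eval (φ z)‖ := by
    have e0 : ‖(blockPoly (fun _ => 1) m c).eval (φ z)‖ =
        ‖c * (blockPoly (fun _ => 1) m c).eval (φ z)‖ := by rw [norm_mul, hc, one_mul]
    have e1 : c * (blockPoly (fun _ => 1) m c).eval (φ z) =
        ((∑ j ∈ Finset.Ico m (m ^ 2), 1 / ((j : ℝ) + 2) * x ^ (j + 2) : ℝ) : ℂ) := by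
      rw [eval_blockPoly, Finset.mul_sum]
      push_cast
      refine Finset.sum_congr rfl fun j _ => ?_
      rw [← hcz]
      ring
    rw [e0, e1, Complex.norm_real, Real.norm_eq_abs,
      abs_of_nonneg (Finset.sum_nonneg fun j _ => by positivity)]
    have h6 : Real.log m / 4 ≤ ∑ j ∈ Finset.Ico m (m ^ 2), 1 / ((j : ℝ) + 2) := by
      have : Real.log m / 4 ≤ ∑ j ∈ Finset.Ico m (m ^ 2), ((j : ℝ) + 1)⁻¹ / 2 := by
        rw [← Finset.sum_div]
        linarith
      refine this.trans (Finset.sum_le_sum fun j _ => ?_)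
      rw [← one_div, div_div]
      exact one_div_le_one_div_of_le (by positivity)
        (by linarith [(Nat.cast_nonneg j : (0 : ℝ) ≤ j)])
    refine (mul_le_mul_of_nonneg_right h6 (pow_nonneg hx0 n)).trans ?_
    rw [Finset.sum_mul]
    refine Finset.sum_le_sum fun j hj => mul_le_mul_of_nonneg_left ?_ (by positivity)
    have := (Finset.mem_Ico.1 hj).2
    exact pow_le_pow_of_le_one hx0 hx.le (by omega)
  set p := (blockPoly (fun _ => 1) m c).eval (φ z)
  set q := (blockPoly (fun _ => 1) m c).derivative.eval (φ z)
  have h6 : ‖w‖ * ‖p‖ ≤ ‖u * q + w * p‖ + ‖u‖ * ‖q‖ := by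
    have := norm_sub_le (u * q + w * p) (u * q)
    rwa [add_sub_cancel_left, norm_mul, norm_mul] at this
  have h7 := mul_le_mul_of_nonneg_left (h4.trans hkx)
    (by positivity : 0 ≤ stdWeight β z * ‖u‖)
  have h8 := mul_le_mul_of_nonneg_left h6 hv.le
  have h9 := mul_le_mul_of_nonneg_left h5 (by positivity : 0 ≤ stdWeight β z * ‖w‖)
  have h10 := mul_le_mul_of_nonneg_right hn2
    (by positivity : 0 ≤ stdWeight β z * ‖w‖ * x ^ n)
  rw [norm_mul, norm_pow]
  linarith

end Logarithmic

/-! ### Assembling the ranges of the exponent -/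

theorem theorem3p2 (α β : ℝ) (hα : 0 < α) (hβ : 0 < β) :
    ∃ C₁ C₂ : ℝ, 0 < C₁ ∧ 0 < C₂ ∧
      ∀ (φ g : ℂ → ℂ),
        DifferentiableOn ℂ φ (Metric.ball 0 1) →
        Set.MapsTo φ (Metric.ball 0 1) (Metric.ball 0 1) →
        DifferentiableOn ℂ g (Metric.ball 0 1) →
        ∀ T : ZygmundSpace α →L[ℂ] ZygmundSpace β,
          (∀ (f : ZygmundSpace α), ∀ z ∈ Metric.ball (0 : ℂ) 1, T f z = compVolterraU φ g f z) →
          (α < 1 → IsCompactOperator T ∧ essNorm T = 0) ∧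
          (α = 1 → Comparable C₁ C₂ (ENNReal.ofReal (essNorm T))
            (limsupPow β (fun n => Real.log n) (symbolU φ g) φ)) ∧
          (1 < α → α < 2 → Comparable C₁ C₂ (ENNReal.ofReal (essNorm T))
            (limsupPow β (fun n => ((n : ℝ) + 1) ^ (α - 1)) (symbolU φ g) φ)) ∧
          (α = 2 → Comparable C₁ C₂ (ENNReal.ofReal (essNorm T))
            (max (limsupPow β (fun n => (n : ℝ) + 1) (symbolU φ g) φ)
              (limsupPow β (fun n => Real.log n) (symbolW φ g) φ))) ∧
          (2 < α → Comparable C₁ C₂ (ENNReal.ofReal (essNorm T))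
            (max (limsupPow β (fun n => ((n : ℝ) + 1) ^ (α - 1)) (symbolU φ g) φ)
              (limsupPow β (fun n => ((n : ℝ) + 1) ^ (α - 2)) (symbolW φ g) φ))) := by
  have hexcl : ∀ {P : Prop}, ¬ P → ∀ {Q : Prop}, P → Q := fun h _ h' => (h h').elim
  rcases lt_trichotomy α 1 with hα1 | rfl | hα1
  · refine ⟨1, 1, one_pos, one_pos, fun φ g hφ hm hg T hT => ⟨fun _ => ?_, hexcl hα1.ne,
      hexcl hα1.not_gt, hexcl (by linarith), hexcl (by linarith)⟩⟩
    have hK := isCompactOperator_of_lt_one hα.le hα1 hβ.le hφ hm hg T hT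
    exact ⟨hK, essNorm_eq_zero hK⟩
  · obtain ⟨C₁, hC₁, h₁⟩ := exists_ofReal_mul_essNorm_le (β := β) hα.le
      ZygmundSpace.dilationBound_one
      (dominatedBy_log zero_le_one)
    obtain ⟨C₂, hC₂, h₂⟩ := exists_limsupPow_log_symbolU_le
    exact ⟨C₁, C₂, hC₁, hC₂, fun φ g hφ hm hg T hT => ⟨hexcl (lt_irrefl _),
      fun _ => ⟨h₁ φ g hφ hm hg T hT, h₂ β φ g hφ hm hg T hT⟩,
      hexcl (lt_irrefl _), hexcl (by norm_num), hexcl (by norm_num)⟩⟩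
  rcases lt_trichotomy α 2 with hα2 | rfl | hα2
  · have hα1' : 0 < α - 1 := by linarith
    obtain ⟨C₁, hC₁, h₁⟩ := exists_ofReal_mul_essNorm_le (β := β) hα.le
      (ZygmundSpace.dilationBound_of_lt_two hα1 hα2) (dominatedBy_rpow (by positivity) hα1'.le)
    obtain ⟨C₂, hC₂, h₂⟩ := exists_limsupPow_symbolU_le_of_lt_two hα1 hα2
    exact ⟨C₁, C₂, hC₁, hC₂, fun φ g hφ hm hg T hT => ⟨hexcl hα1.not_gt, hexcl hα1.ne',
      fun _ _ => ⟨h₁ φ g hφ hm hg T hT, h₂ β φ g hφ hm hg T hT⟩, hexcl hα2.ne,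
      hexcl hα2.not_gt⟩⟩
  · obtain ⟨C₁, hC₁, h₁⟩ := exists_ofReal_mul_essNorm_le_max (β := β) hα.le
      ZygmundSpace.dilationBound_two
      (dominatedBy_log zero_le_two) (dominatedBy_rpow two_pos zero_le_one)
    obtain ⟨C₂, hC₂, h₂⟩ := exists_limsupPow_symbolU_le (le_refl (2 : ℝ))
    obtain ⟨C₃, hC₃, h₃⟩ := exists_limsupPow_log_symbolW_le
    -- For `α = 2` the weight `(n + 1)^(α - 1)` is `n + 1`.
    norm_num only [Real.rpow_one] at h₁ h₂
    refine ⟨C₁, max C₂ C₃, hC₁, lt_max_of_lt_left hC₂, fun φ g hφ hm hg T hT =>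
      ⟨hexcl hα1.not_gt, hexcl hα1.ne', fun _ => hexcl (lt_irrefl _), fun _ =>
        ⟨h₁ φ g hφ hm hg T hT, max_le ?_ ?_⟩, hexcl (lt_irrefl _)⟩⟩
    · exact (h₂ β φ g hφ hm hg T hT).trans
        (mul_le_mul_left (ENNReal.ofReal_le_ofReal (le_max_left _ _)) _)
    · exact (h₃ β φ g hφ hm hg T hT).trans
        (mul_le_mul_left (ENNReal.ofReal_le_ofReal (le_max_right _ _)) _)
  · have hα1' : 0 < α - 1 := by linarith
    have hα2' : 0 < α - 2 := by linarith
    obtain ⟨C₁, hC₁, h₁⟩ := exists_ofReal_mul_essNorm_le_max (β := β) hα.le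
      (ZygmundSpace.dilationBound_of_two_lt hα2) (dominatedBy_rpow (by positivity) hα2'.le)
      (dominatedBy_rpow (by positivity) hα1'.le)
    obtain ⟨C₂, hC₂, h₂⟩ := exists_limsupPow_symbolU_le hα2.le
    obtain ⟨C₃, hC₃, h₃⟩ := exists_limsupPow_symbolW_le hα2.le
    refine ⟨C₁, max C₂ C₃, hC₁, lt_max_of_lt_left hC₂, fun φ g hφ hm hg T hT =>
      ⟨hexcl hα1.not_gt, hexcl hα1.ne', fun _ => hexcl hα2.not_gt, hexcl hα2.ne', fun _ =>
        ⟨h₁ φ g hφ hm hg T hT, max_le ?_ ?_⟩⟩⟩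
    · exact (h₂ β φ g hφ hm hg T hT).trans
        (mul_le_mul_left (ENNReal.ofReal_le_ofReal (le_max_left _ _)) _)
    · exact (h₃ β φ g hφ hm hg T hT).trans
        (mul_le_mul_left (ENNReal.ofReal_le_ofReal (le_max_right _ _)) _)
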